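/- An additively separable hedonic game (ASHG) is a loopless digraph $G=(V,E)$ with a weight function $w:V\times V\to\mathbb{Z}$ such that $w(u,v)=0$ whenever $uv\notin E$ (arcs may have weight $0$). The utility of $v\in V$ for $S\subseteq V$ is $p_v(S)=\sum_{u\in S\setminus\{v\}}w(v,u)$. A partition $\pi$ of $V$ is Nash stable if for every $S\in\pi$ and $v\in S$ we have $p_v(S)\ge 0$ and $p_v(S)\ge p_v(S')$ for all $S'\in\pi$; it is connected Nash stable if moreover every class of $\pi$ is connected in the underlying undirected graph of $G$. Connected Nash Stability is the problem of deciding whether a given ASHG has a connected Nash stable partition. Maximum degree and pathwidth are those of the underlying graph. Corollary. There are constants $\Delta$ and $W$ such that the following holds. Assume the Exponential Time Hypothesis, in the form that no algorithm decides 3-SAT on formulas with $n$ variables and $m$ clauses in time $2^{o(n)}(n+m)^{O(1)}$. Then no algorithm decides Connected Nash Stability on the ASHGs of maximum degree at most $\Delta$ all of whose weights have absolute value at most $W$ in time $p^{o(p)}n^{O(1)}$, where $n$ is the number of vertices and $p$ is the pathwidth; precisely, there are no $f:\mathbb{N}\to\mathbb{R}$ with $f(p)=o(p)$ and constants $C$,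 $d$ such that some algorithm solves all these instances in time at most $C\,(p+2)^{f(p)}(n+1)^{d}$. (Algorithms are deterministic; running times are those of a random access machine with unit-cost addition and subtraction, which are polynomially related to those of Turing machines.) -/

import Mathlib

open Filter Asymptotics

/-! ### Additively separable hedonic games -/

/-- An additively separable hedonic game on the vertex set `V`: a loopless digraph together with
integer weights that vanish off the arcs (an arc may have weight `0`). -/
structure ASHG (V : Type*) where
  graph : Digraph V
  loopless : ∀ v, ¬ graph.Adj v v
  weight : V → V → ℤ
  weight_eq_zero : ∀ u v, ¬ graph.Adj u v → weight u v = 0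

namespace ASHG

variable {V : Type*}

/-- The underlying graph, obtained by forgetting the directions of all arcs. -/
def underlying (G : ASHG V) : SimpleGraph V := G.graph.toSimpleGraphInclusive

/-- The utility `p_v(S) = ∑_{u ∈ S \ {v}} w(v, u)`. -/
def utility [DecidableEq V] (G : ASHG V) (v : V) (S : Finset V) : ℤ :=
  ∑ u ∈ S.erase v, G.weight v u

/-- A partition is Nash stable if no vertex can strictly increase its utility by forming a
singleton coalition or by joining another coalition. -/
def NashStable [Fintype V] [DecidableEq V] (G : ASHG V)
    (π : Finpartition (Finset.univ : Finset V)) : Prop :=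
  ∀ S ∈ π.parts, ∀ v ∈ S, 0 ≤ G.utility v S ∧ ∀ S' ∈ π.parts, G.utility v S' ≤ G.utility v S

/-- A Nash stable partition all of whose classes are connected in the underlying graph. -/
def ConnectedNashStable [Fintype V] [DecidableEq V] (G : ASHG V)
    (π : Finpartition (Finset.univ : Finset V)) : Prop :=
  G.NashStable π ∧ ∀ S ∈ π.parts, (G.underlying.induce (S : Set V)).Connected

open Classical in
/-- The maximum degree of the underlying graph. -/
noncomputable def maxDegree [Fintype V] (G : ASHG V) : ℕ := G.underlying.maxDegree

end ASHG

/-! ### Pathwidth -/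

/-- A path decomposition: a sequence of bags that covers all vertices and all edges and in which
the bags containing a given vertex are consecutive. -/
structure PathDecomposition {V : Type*} (G : SimpleGraph V) where
  length : ℕ
  bag : Fin length → Finset V
  vertex_mem : ∀ v, ∃ i, v ∈ bag i
  edge_mem : ∀ u v, G.Adj u v → ∃ i, u ∈ bag i ∧ v ∈ bag i
  consecutive : ∀ v i j k, i ≤ j → j ≤ k → v ∈ bag i → v ∈ bag k → v ∈ bag j

/-- The pathwidth of a finite graph: the least `k` such that there is a path decomposition all of
whose bags have at most `k + 1` elements. -/
noncomputable def pathwidth {V : Type*} (G : SimpleGraph V) : ℕ :=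
  sInf {k | ∃ X : PathDecomposition G, ∀ i, (X.bag i).card ≤ k + 1}

/-! ### Random access machines

A program works on finitely many arrays of natural numbers; cells are addressed indirectly.
The only arithmetic operations are addition and truncated subtraction, each charged one time unit
(as is each constant, each memory access and each test), so that running times are polynomially related
to those of multitape Turing machines. -/

namespace RAM

/-- A memory: `s a i` is the content of cell `i` of the array `a`. -/
abbrev Store := ℕ → ℕ → ℕ

/-- Expressions: constants, the cell of the array `a` whose address is given by an expression,
sums and truncated differences. -/
inductive Expr where
  | const (n : ℕ) : Expr
  | read (a : ℕ) (i : Expr) : Expr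
  | add (e₁ e₂ : Expr) : Expr
  | sub (e₁ e₂ : Expr) : Expr

namespace Expr

def eval (s : Store) : Expr → ℕ
  | const n => n
  | read a i => s a (i.eval s)
  | add e₁ e₂ => e₁.eval s + e₂.eval s
  | sub e₁ e₂ => e₁.eval s - e₂.eval s

/-- The time needed to evaluate an expression: its number of operations. -/
def cost : Expr → ℕ
  | const _ => 1
  | read _ i => i.cost + 1
  | add e₁ e₂ => e₁.cost + e₂.cost + 1
  | sub e₁ e₂ => e₁.cost + e₂.cost + 1

end Expr

/-- Programs. The array names occurring in a program are fixed; `ite` and `loop` test whether an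
expression is nonzero. -/
inductive Prog where
  | skip : Prog
  | write (a : ℕ) (i e : Expr) : Prog
  | seq (P Q : Prog) : Prog
  | ite (e : Expr) (P Q : Prog) : Prog
  | loop (e : Expr) (P : Prog) : Prog

/-- The memory after the value `x` has been written to cell `i` of the array `a`. -/
def Store.set (s : Store) (a i x : ℕ) : Store :=
  Function.update s a (Function.update (s a) i x)

/-- `Runs P s t s'`: started on the memory `s`, the program `P` halts after exactly `t` steps with
the memory `s'`. -/
inductive Runs : Prog → Store → ℕ → Store → Prop where
  | skip (s : Store) : Runs .skip s 1 s
  | write (a : ℕ) (i e : Expr) (s : Store) :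
      Runs (.write a i e) s (i.cost + e.cost + 1) (s.set a (i.eval s) (e.eval s))
  | seq {P Q : Prog} {s s' s'' : Store} {t t' : ℕ} :
      Runs P s t s' → Runs Q s' t' s'' → Runs (.seq P Q) s (t + t') s''
  | ite_true {e : Expr} {P Q : Prog} {s s' : Store} {t : ℕ} :
      e.eval s ≠ 0 → Runs P s t s' → Runs (.ite e P Q) s (e.cost + t + 1) s'
  | ite_false {e : Expr} {P Q : Prog} {s s' : Store} {t : ℕ} :
      e.eval s = 0 → Runs Q s t s' → Runs (.ite e P Q) s (e.cost + t + 1) s'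
  | loop_true {e : Expr} {P : Prog} {s s' s'' : Store} {t t' : ℕ} :
      e.eval s ≠ 0 → Runs P s t s' → Runs (.loop e P) s' t' s'' →
      Runs (.loop e P) s (e.cost + t + t' + 1) s''
  | loop_false {e : Expr} {P : Prog} {s : Store} :
      e.eval s = 0 → Runs (.loop e P) s (e.cost + 1) s

/-- The initial memory for an input that consists of finitely many lists: the `a`-th list stands
in the array `a`, and all other cells are `0`. -/
def load (input : List (List ℕ)) : Store := fun a i => (input.getD a []).getD i 0

/-- On the given input, `P` halts within time `T` and answers the yes/no question `yes`
correctly: cell `0` of the array `0` finally holds `1` if `yes` is true, and `0` otherwise. -/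
def Answers (P : Prog) (input : List (List ℕ)) (yes : Prop) (T : ℝ) : Prop :=
  ∃ (t : ℕ) (s : Store), Runs P (load input) t s ∧ (t : ℝ) ≤ T ∧
    ((yes ∧ s 0 0 = 1) ∨ (¬ yes ∧ s 0 0 = 0))

end RAM

open Classical in
/-- The encoding of a game with vertex set `{0, …, n - 1}`: the number `n`, the adjacency matrix
of the digraph, and the matrices of the positive and of the negative parts of the weights, each
listed row by row. -/
noncomputable def ASHG.encode {n : ℕ} (G : ASHG (Fin n)) : List (List ℕ) :=
  [[n],
   List.ofFn fun k : Fin (n * n) => if G.graph.Adj k.divNat k.modNat then 1 else 0,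
   List.ofFn fun k : Fin (n * n) => (G.weight k.divNat k.modNat).toNat,
   List.ofFn fun k : Fin (n * n) => (-G.weight k.divNat k.modNat).toNat]

/-! ### 3-SAT and the Exponential Time Hypothesis -/

/-- A 3-CNF formula over the variables `x_0, …, x_{n-1}`: a list of clauses of three (not
necessarily distinct) literals; the literal `(i, true)` is `x_i`, and `(i, false)` is its
negation. -/
abbrev ThreeCNF (n : ℕ) := List (Fin 3 → Fin n × Bool)

namespace ThreeCNF

def Satisfiable {n : ℕ} (φ : ThreeCNF n) : Prop :=
  ∃ σ : Fin n → Bool, ∀ c ∈ φ, ∃ k, σ (c k).1 = (c k).2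

/-- The encoding of a formula: the numbers of variables and of clauses, the list of the variables
of the literals, and the list of their signs. -/
def encode {n : ℕ} (φ : ThreeCNF n) : List (List ℕ) :=
  [[n, φ.length],
   φ.flatMap fun c => List.ofFn fun k => ((c k).1 : ℕ),
   φ.flatMap fun c => List.ofFn fun k => (c k).2.toNat]

end ThreeCNF

/-- The Exponential Time Hypothesis, in the form that 3-SAT on formulas with `n` variables and `m`
clauses cannot be solved in time `2^{o(n)} (n + m)^{O(1)}`. This follows from the form that for
some `c > 1` there is no algorithm with running time `c^n (n + m)^{O(1)}`, so that results that
assume only the present form are the stronger ones. -/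
def ETH : Prop :=
  ¬ ∃ (P : RAM.Prog) (f : ℕ → ℝ) (C : ℝ) (d : ℕ),
    f =o[atTop] (fun n : ℕ => (n : ℝ)) ∧
    ∀ (n : ℕ) (φ : ThreeCNF n),
      RAM.Answers P φ.encode φ.Satisfiable
        (C * (2 : ℝ) ^ f n * ((n : ℝ) + φ.length + 1) ^ d)

/-! A formula with `n` variables is translated, in polynomial time, into a game of pathwidth `O(n /
log n)` with bounded degree and weights that has a connected Nash stable partition if and only if
the formula is satisfiable. Since then `p log p = O(n)` for the pathwidth `p`, running time
`p^{o(p)}` for the games becomes `2^{o(n)}` for 3-SAT, against the hypothesis.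

The translation passes through straight-line nondeterministic programs (`Slot`), whose registers
hold abstract values that can only be copied and asserted to differ. The game of a program has one
layer per instruction, and the class of a vertex plays the role of the content of a register at a
given time. A register vertex likes only the vertices of the previous layer from which its content
may come, so stability places it with one of them. A check vertex is pursued by a follower that it
dislikes. It therefore needs the liked `lhs` in its class and cannot afford the disliked `rhs`
there, so that the two registers have different contents (`exists_run_of_nashStable`). Conversely, a
run that starts with pairwise different values colours the vertices, and the colour classes are
stable; they are connected because every occurrence of a value can be traced back through copies to
the one register that held it initially (`exists_connectedNashStable`). The pathwidth is linear in
the number of registers, whatever the length of the program.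

To save registers, the variables are divided into groups of `l`, about `log_4 n`. Some `2 ^ l =
O(√n)` registers name the possible assignments of a group, and one further register per group holds
a guessed name, which makes `O(n / log n)` registers in all. Only inequality can be tested, so a
literal is verified by asserting that the guess for its group differs from every assignment that
falsifies the literal; in every clause the program guesses which literals to verify
(`satSlots_sound`, `exists_exec_satSlots`).

It remains to carry out the translation on the machine (`answers_reduce`) and to show that the
resulting exponent is `o(n)` (`exponent_isLittleO`). -/

/-! ### Nondeterministic register programs -/

/-- One instruction of a nondeterministic register program: the register `tgt` receives the content
of `src₁` or that of `src₂`, and afterwards the registers `lhs` and `rhs` must differ. -/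
structure Slot where
  tgt : ℕ
  src₁ : ℕ
  src₂ : ℕ
  lhs : ℕ
  rhs : ℕ

namespace Slot

instance : Inhabited Slot := ⟨⟨0, 0, 0, 0, 0⟩⟩

/-- All registers of the instruction are smaller than `R`. -/
def WF (R : ℕ) (c : Slot) : Prop :=
  c.tgt < R ∧ c.src₁ < R ∧ c.src₂ < R ∧ c.lhs < R ∧ c.rhs < R

/-- A possible effect of an instruction on the contents of the registers. -/
def Step {α : Type*} (c : Slot) (σ τ : ℕ → α) : Prop :=
  (τ c.tgt = σ c.src₁ ∨ τ c.tgt = σ c.src₂) ∧ (∀ r, r ≠ c.tgt → τ r = σ r) ∧ τ c.lhs ≠ τ c.rhs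

/-- A possible effect of a program. -/
def Exec {α : Type*} : List Slot → (ℕ → α) → (ℕ → α) → Prop
  | [], σ, τ => τ = σ
  | c :: L, σ, τ => ∃ ρ, c.Step σ ρ ∧ Exec L ρ τ

theorem exec_append {α : Type*} {L₁ L₂ : List Slot} {σ τ : ℕ → α} :
    Exec (L₁ ++ L₂) σ τ ↔ ∃ ρ, Exec L₁ σ ρ ∧ Exec L₂ ρ τ := by
  induction L₁ generalizing σ with
  | nil => simp [Exec]
  | cons c L ih =>
    simp only [List.cons_append, Exec, ih]
    constructor
    · rintro ⟨ρ, h, ρ', h', h''⟩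
      exact ⟨ρ', ⟨ρ, h, h'⟩, h''⟩
    · rintro ⟨ρ', ⟨ρ, h, h'⟩, h''⟩
      exact ⟨ρ, h, ρ', h', h''⟩

/-- The layers of the game are indexed by time, so runs are also needed as sequences of states. This
lemma and `steps_of_exec` pass between the two views. -/
theorem exec_of_steps {α : Type*} {L : List Slot} {x : ℕ → ℕ → α}
    (h : ∀ t < L.length, (L.getD t default).Step (x t) (x (t + 1))) :
    Exec L (x 0) (x L.length) := by
  induction L generalizing x with
  | nil => simp [Exec]
  | cons c L ih =>
    refine ⟨x 1, by simpa using h 0 (by simp), ?_⟩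
    refine ih (x := fun t => x (t + 1)) fun t ht => ?_
    simpa using h (t + 1) (by simpa using ht)

theorem steps_of_exec {α : Type*} {L : List Slot} {σ τ : ℕ → α} (h : Exec L σ τ) :
    ∃ x : ℕ → ℕ → α, x 0 = σ ∧ ∀ t < L.length, (L.getD t default).Step (x t) (x (t + 1)) := by
  induction L generalizing σ with
  | nil => exact ⟨fun _ => σ, rfl, by simp⟩
  | cons c L ih =>
    obtain ⟨ρ, h, h'⟩ := h
    obtain ⟨x, hx, hs⟩ := ih h'
    refine ⟨fun t => Nat.casesOn t σ x, rfl, fun t ht => ?_⟩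
    cases t with
    | zero => simpa [hx] using h
    | succ t => simpa using hs t (by simpa using ht)

end Slot

/-! ### Generalities on hedonic games -/

namespace ASHG

theorem utility_eq_sum {V : Type*} [DecidableEq V] (G : ASHG V) (v : V) (S : Finset V) :
    G.utility v S = ∑ u ∈ S, G.weight v u :=
  Finset.sum_erase _ (G.weight_eq_zero _ _ (G.loopless v))

/-- In a Nash stable partition, a vertex that dislikes nobody is together with somebody whom it
likes, if there is such a vertex at all. -/
theorem NashStable.exists_mem_part {V : Type*} [Fintype V] [DecidableEq V] {G : ASHG V}
    {π : Finpartition (Finset.univ : Finset V)}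
    (h : G.NashStable π) {v u : V} (h₀ : ∀ u, 0 ≤ G.weight v u) (hu : 0 < G.weight v u) :
    ∃ u', 0 < G.weight v u' ∧ π.part u' = π.part v := by
  -- Joining the class of `u` would pay at least `w(v, u) > 0`. So the class of `v` pays a positive
  -- amount too, and some summand in it is positive.
  have h1 := (h _ (π.part_mem.2 (Finset.mem_univ v)) v (π.mem_part (Finset.mem_univ v))).2 _
    (π.part_mem.2 (Finset.mem_univ u))
  simp only [utility_eq_sum] at h1
  have h2 : G.weight v u ≤ ∑ w ∈ π.part u, G.weight v w :=
    Finset.single_le_sum (fun w _ => h₀ w) (π.mem_part (Finset.mem_univ u))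
  obtain ⟨w, hw, hw0⟩ := Finset.exists_lt_of_sum_lt
    (f := fun _ => (0 : ℤ)) (s := π.part v) (g := fun w => G.weight v w) (by simp; omega)
  exact ⟨w, hw0, π.part_eq_of_mem (π.part_mem.2 (Finset.mem_univ v)) hw⟩

end ASHG

/-! ### The game of a register program -/

namespace Slot

/-- The weights that the vertex `i` of layer `t` puts on the vertex `i'` of layer `t'`: the sum of
its positive terms. In every layer the vertices `i < R` are copies of the registers; the vertex `R`
checks the assertion, and the vertex `R + 1` follows the vertex `R`. -/
def plus (R : ℕ) (L : List Slot) (t i t' i' : ℕ) : ℕ :=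
  if i = R then (if t = t' ∧ i' = (L.getD t default).lhs then 1 else 0)
  else if i = R + 1 then (if t = t' ∧ i' = R then 1 else 0)
  else if t = t' + 1 then
    (if i = (L.getD t default).tgt then
      (if i' = (L.getD t default).src₁ then 1 else 0) +
        (if i' = (L.getD t default).src₂ then 1 else 0)
    else if i' = i then 2 else 0)
  else 0

/-- The sum of the negative terms. -/
def minus (R : ℕ) (L : List Slot) (t i t' i' : ℕ) : ℕ :=
  if i = R ∧ t = t' then
    (if i' = (L.getD t default).rhs then 1 else 0) + (if i' = R + 1 then 1 else 0)
  else 0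

theorem getD_wf {R : ℕ} {L : List Slot} (hL : ∀ c ∈ L, c.WF R) {t : ℕ} (ht : t < L.length) :
    (L.getD t default).WF R := by
  rw [List.getD_eq_getElem _ _ ht]
  exact hL _ (List.getElem_mem ht)

/-- Register vertices refer to the previous layer only, and a check vertex refers to `lhs`, `rhs`
and its follower; `lhs, rhs < R` by well-formedness, so it never refers to itself. -/
theorem plus_add_minus_self {R : ℕ} {L : List Slot} (hL : ∀ c ∈ L, c.WF R) {t : ℕ}
    (ht : t < L.length) (i : ℕ) : plus R L t i t i + minus R L t i t i = 0 := by
  obtain ⟨-, -, -, h1, h2⟩ := getD_wf hL ht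
  unfold plus minus
  split_ifs <;> omega

theorem layer_lt {T R : ℕ} (u : Fin (T * (R + 2))) : (u : ℕ) / (R + 2) < T :=
  Nat.div_lt_of_lt_mul (lt_of_lt_of_eq u.2 (mul_comm _ _))

/-- The hedonic game of a register program with `R` registers. -/
def game (R : ℕ) (L : List Slot) (hL : ∀ c ∈ L, c.WF R) : ASHG (Fin (L.length * (R + 2))) where
  -- An arc is present as soon as some term is nonzero, even where the terms cancel, as they do if
  -- `lhs = rhs`.
  graph := ⟨fun u v =>
    plus R L (u / (R + 2)) (u % (R + 2)) (v / (R + 2)) (v % (R + 2)) +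
      minus R L (u / (R + 2)) (u % (R + 2)) (v / (R + 2)) (v % (R + 2)) ≠ 0⟩
  loopless := fun v h => h (plus_add_minus_self hL (layer_lt v) _)
  weight := fun u v =>
    (plus R L (u / (R + 2)) (u % (R + 2)) (v / (R + 2)) (v % (R + 2)) : ℤ) -
      minus R L (u / (R + 2)) (u % (R + 2)) (v / (R + 2)) (v % (R + 2))
  weight_eq_zero := by
    intro u v h
    simp only [ne_eq, Nat.add_eq_zero_iff, not_not] at h
    simp [h.1, h.2]

theorem vtx_aux {T R t i : ℕ} (ht : t < T) (hi : i < R + 2) : t * (R + 2) + i < T * (R + 2) :=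
  calc t * (R + 2) + i < t * (R + 2) + (R + 2) := by omega
    _ = (t + 1) * (R + 2) := by ring
    _ ≤ T * (R + 2) := Nat.mul_le_mul_right _ ht

/-- The vertex `i` of layer `t`. -/
def vtx {T R : ℕ} (t i : ℕ) (ht : t < T) (hi : i < R + 2) : Fin (T * (R + 2)) :=
  ⟨t * (R + 2) + i, vtx_aux ht hi⟩

@[simp] theorem vtx_div {T R t i : ℕ} (ht : t < T) (hi : i < R + 2) :
    (vtx t i ht hi : ℕ) / (R + 2) = t := by
  simp only [vtx]
  rw [mul_comm, Nat.mul_add_div (by omega), Nat.div_eq_of_lt hi, add_zero]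

@[simp] theorem vtx_mod {T R t i : ℕ} (ht : t < T) (hi : i < R + 2) :
    (vtx t i ht hi : ℕ) % (R + 2) = i := by
  simp only [vtx]
  rw [mul_comm, Nat.mul_add_mod, Nat.mod_eq_of_lt hi]

theorem eq_vtx_iff {T R t i : ℕ} (ht : t < T) (hi : i < R + 2) (u : Fin (T * (R + 2))) :
    u = vtx t i ht hi ↔ (u : ℕ) / (R + 2) = t ∧ (u : ℕ) % (R + 2) = i := by
  constructor
  · rintro rfl
    simp
  · rintro ⟨rfl, rfl⟩
    ext
    exact (Nat.div_add_mod' _ _).symm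

theorem exists_eq_vtx {T R : ℕ} (u : Fin (T * (R + 2))) : ∃ t i, ∃ (ht : t < T) (hi : i < R + 2),
    u = vtx t i ht hi :=
  ⟨_, _, layer_lt u, Nat.mod_lt _ (by omega), (eq_vtx_iff _ _ _).2 ⟨rfl, rfl⟩⟩

/-! ### The weights of each kind of vertex -/

section Weights

variable {R : ℕ} {L : List Slot} (hL : ∀ c ∈ L, c.WF R)

/-- Layer 0 has no predecessor; its registers are indifferent, so the initial contents are free. -/
theorem weight_zero {i : ℕ} (hi : i < R) (h0 : 0 < L.length) (u) :
    (game R L hL).weight (vtx 0 i h0 (by omega)) u = 0 := by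
  have h1 : i ≠ R := by omega
  have h2 : i ≠ R + 1 := by omega
  simp [game, plus, minus, h1, h2]

theorem weight_tgt {t : ℕ} (ht : t + 1 < L.length) (u) :
    (game R L hL).weight (vtx (t + 1) (L.getD (t + 1) default).tgt ht
      (by have := getD_wf hL ht; unfold WF at this; omega)) u =
    (if u = vtx t (L.getD (t + 1) default).src₁ (by omega)
      (by have := getD_wf hL ht; unfold WF at this; omega) then 1 else 0) +
    (if u = vtx t (L.getD (t + 1) default).src₂ (by omega)
      (by have := getD_wf hL ht; unfold WF at this; omega) then 1 else 0) := by
  have h := getD_wf hL ht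
  unfold WF at h
  simp only [game, vtx_div, vtx_mod, plus, minus, eq_vtx_iff]
  split_ifs <;> omega

theorem weight_copy {t i : ℕ} (ht : t + 1 < L.length) (hi : i < R)
    (hn : i ≠ (L.getD (t + 1) default).tgt) (u) :
    (game R L hL).weight (vtx (t + 1) i ht (by omega)) u =
    if u = vtx t i (by omega) (by omega) then 2 else 0 := by
  simp only [game, vtx_div, vtx_mod, plus, minus, eq_vtx_iff]
  split_ifs <;> omega

/-- Once the follower is in the class, nonnegative utility forces `lhs` in and `rhs` out. -/
theorem weight_check {t : ℕ} (ht : t < L.length) (u) :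
    (game R L hL).weight (vtx t R ht (by omega)) u =
    (if u = vtx t (L.getD t default).lhs ht
      (by have := getD_wf hL ht; unfold WF at this; omega) then 1 else 0) -
    (if u = vtx t (L.getD t default).rhs ht
      (by have := getD_wf hL ht; unfold WF at this; omega) then 1 else 0) -
    (if u = vtx t (R + 1) ht (by omega) then 1 else 0) := by
  simp only [game, vtx_div, vtx_mod, plus, minus, eq_vtx_iff, if_true, true_and,
    eq_comm (a := (u : ℕ) / (R + 2))]
  by_cases h : t = (u : ℕ) / (R + 2) <;> simp [h, sub_sub]

theorem weight_follow {t : ℕ} (ht : t < L.length) (u) :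
    (game R L hL).weight (vtx t (R + 1) ht (by omega)) u =
    if u = vtx t R ht (by omega) then 1 else 0 := by
  simp only [game, vtx_div, vtx_mod, plus, minus, eq_vtx_iff]
  split_ifs <;> omega

theorem abs_weight_le (u v) : |(game R L hL).weight u v| ≤ 2 := by
  simp only [game, plus, minus, abs_le]
  split_ifs <;> simp

end Weights

/-! #### Stable partitions yield runs -/

/-- The content of a register at time `t` is the class of its vertex in layer `t`. The instruction
with number 0 has no layer before it, so the run consists of the transitions into the layers from 1
on. -/
theorem exists_run_of_nashStable {R : ℕ} {L : List Slot} (hL : ∀ c ∈ L, c.WF R)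
    {π : Finpartition (Finset.univ : Finset (Fin (L.length * (R + 2))))}
    (h : (game R L hL).NashStable π) :
    ∃ x : ℕ → ℕ → Finset (Fin (L.length * (R + 2))),
      ∀ t, t + 1 < L.length → (L.getD (t + 1) default).Step (x t) (x (t + 1)) := by
  classical
  -- Numbers from `R` on are not registers; the constant `∅` makes them unchanged in every step.
  let x : ℕ → ℕ → Finset (Fin (L.length * (R + 2))) := fun t i =>
    if hi : t < L.length ∧ i < R then π.part (vtx t i hi.1 (by omega)) else ∅
  have hx : ∀ t i (ht : t < L.length) (hi : i < R), x t i = π.part (vtx t i ht (by omega)) :=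
    fun t i ht hi => dif_pos ⟨ht, hi⟩
  have hx' : ∀ t i, ¬ i < R → x t i = ∅ := fun t i hi => dif_neg fun h => hi h.2
  refine ⟨x, fun t ht => ?_⟩
  have hwf := getD_wf hL ht
  obtain ⟨w1, w2, w3, w4, w5⟩ := hwf
  refine ⟨?_, fun r hr => ?_, ?_⟩
  · rw [hx _ _ ht w1, hx _ _ (by omega) w2, hx _ _ (by omega) w3]
    obtain ⟨u, hu, hp⟩ := h.exists_mem_part (v := vtx (t + 1) (L.getD (t + 1) default).tgt ht
      (by omega)) (u := vtx t (L.getD (t + 1) default).src₁ (by omega) (by omega))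
      (fun u => by rw [weight_tgt hL ht]; positivity)
      (by rw [weight_tgt hL ht, if_pos rfl]; positivity)
    rw [weight_tgt hL ht] at hu
    split_ifs at hu with h1 h2 h2
    · left; rw [← hp, h1]
    · left; rw [← hp, h1]
    · right; rw [← hp, h2]
    · simp at hu
  · by_cases hrR : r < R
    · rw [hx _ _ ht hrR, hx _ _ (by omega) hrR]
      obtain ⟨u, hu, hp⟩ := h.exists_mem_part (v := vtx (t + 1) r ht (by omega))
        (u := vtx t r (by omega) (by omega))
        (fun u => by rw [weight_copy hL ht hrR hr]; positivity)
        (by rw [weight_copy hL ht hrR hr, if_pos rfl]; positivity)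
      rw [weight_copy hL ht hrR hr] at hu
      split_ifs at hu with h1
      · rw [← hp, h1]
      · simp at hu
    · rw [hx' _ _ hrR, hx' _ _ hrR]
  · rw [hx _ _ ht w4, hx _ _ ht w5]
    obtain ⟨u, hu, hp⟩ := h.exists_mem_part (v := vtx (t + 1) (R + 1) ht (by omega))
      (u := vtx (t + 1) R ht (by omega))
      (fun u => by rw [weight_follow hL ht]; positivity)
      (by rw [weight_follow hL ht, if_pos rfl]; positivity)
    rw [weight_follow hL ht] at hu
    split_ifs at hu with h1
    swap
    · simp at hu
    rw [h1] at hp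
    -- If `lhs` and `rhs` shared a class, their contributions to the check vertex would cancel and
    -- the follower would leave it with utility `-1`.
    intro he
    have h0 := (h _ (π.part_mem.2 (Finset.mem_univ (vtx (t + 1) R ht (by omega)))) _
      (π.mem_part (Finset.mem_univ (vtx (t + 1) R ht (by omega))))).1
    rw [ASHG.utility_eq_sum] at h0
    simp only [weight_check hL ht, Finset.sum_sub_distrib, Finset.sum_ite_eq'] at h0
    have e1 : ∀ v u, u ∈ π.part v ↔ π.part u = π.part v := fun v u =>
      π.mem_part_iff_part_eq_part (Finset.mem_univ _) (Finset.mem_univ _)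
    simp only [e1, he, hp, if_true] at h0
    omega

/-! #### Runs yield connected stable partitions -/

/-- The colour of a vertex in the partition defined by a run. -/
def color {R : ℕ} (L : List Slot) (x : ℕ → ℕ → ℕ) (v : Fin (L.length * (R + 2))) : ℕ :=
  if (v : ℕ) % (R + 2) < R then x (v / (R + 2)) (v % (R + 2))
  else x (v / (R + 2)) (L.getD (v / (R + 2)) default).lhs

theorem color_vtx {R : ℕ} {L : List Slot} (x : ℕ → ℕ → ℕ) {t i : ℕ} (ht : t < L.length)
    (hi : i < R) : color L x (vtx t i ht (by omega) : Fin (L.length * (R + 2))) = x t i := by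
  simp [color, hi]

theorem color_check {R : ℕ} {L : List Slot} (x : ℕ → ℕ → ℕ) {t : ℕ} (ht : t < L.length) :
    color L x (vtx t R ht (by omega) : Fin (L.length * (R + 2))) =
      x t (L.getD t default).lhs := by
  simp [color]

theorem color_follow {R : ℕ} {L : List Slot} (x : ℕ → ℕ → ℕ) {t : ℕ} (ht : t < L.length) :
    color L x (vtx t (R + 1) ht (by omega) : Fin (L.length * (R + 2))) =
      x t (L.getD t default).lhs := by
  simp [color]

theorem adj_of_weight_ne {V : Type*} (G : ASHG V) {u v : V} (h : G.weight u v ≠ 0) :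
    G.underlying.Adj u v := by
  have h1 : G.graph.Adj u v := not_not.1 fun hn => h (G.weight_eq_zero _ _ hn)
  exact ⟨fun e => G.loopless v (e ▸ h1), Or.inl h1⟩

/-- The classes are the colours, check vertices and followers taking the colour of `lhs`. Each class
grows from a single root in layer 0, the register that initially holds the colour, along arcs to
vertices of the same colour. Layer 0 has a check vertex but no transition, whence the separate
hypothesis `hne`. -/
theorem exists_connectedNashStable {R : ℕ} {L : List Slot} (hL : ∀ c ∈ L, c.WF R)
    (h0 : 0 < L.length) (x : ℕ → ℕ → ℕ) (hx0 : ∀ i, x 0 i = i)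
    (hs : ∀ t, t + 1 < L.length → (L.getD (t + 1) default).Step (x t) (x (t + 1)))
    (hne : (L.getD 0 default).lhs ≠ (L.getD 0 default).rhs) :
    ∃ π : Finpartition (Finset.univ : Finset (Fin (L.length * (R + 2)))),
      (game R L hL).ConnectedNashStable π := by
  classical
  -- Every value that occurs is one of the initial values below `R`, so every class has a root in
  -- layer 0.
  have hlt : ∀ t < L.length, ∀ i < R, x t i < R := by
    intro t
    induction t with
    | zero => intro _ i hi; rwa [hx0]
    | succ t ih =>
      intro ht i hi
      obtain ⟨w1, w2, w3, w4, w5⟩ := getD_wf hL ht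
      obtain ⟨h1, h2, -⟩ := hs t ht
      by_cases he : i = (L.getD (t + 1) default).tgt
      · subst he
        rcases h1 with h1 | h1 <;> rw [h1]
        · exact ih (by omega) _ w2
        · exact ih (by omega) _ w3
      · rw [h2 _ he]
        exact ih (by omega) _ hi
  have hne' : ∀ t < L.length, x t (L.getD t default).lhs ≠ x t (L.getD t default).rhs := by
    intro t ht
    cases t with
    | zero => rwa [hx0, hx0]
    | succ t => exact (hs t ht).2.2
  let col : Fin (L.length * (R + 2)) → ℕ := color L x
  let st : Setoid (Fin (L.length * (R + 2))) := Setoid.ker col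
  let π := Finpartition.ofSetoid st
  have hpart : ∀ S ∈ π.parts, ∀ v ∈ S, ∀ u, u ∈ S ↔ col u = col v := by
    intro S hS v hv u
    rw [← π.part_eq_of_mem hS hv, Finpartition.mem_part_ofSetoid_iff_rel]
    exact ⟨fun h => (Setoid.ker_def.1 h).symm, fun h => Setoid.ker_def.2 h.symm⟩
  have hdisj : ∀ S ∈ π.parts, ∀ S' ∈ π.parts, S' ≠ S → ∀ u ∈ S, u ∉ S' := by
    intro S hS S' hS' hn u hu hu'
    exact hn (π.eq_of_mem_parts hS' hS hu' hu)
  refine ⟨π, ?_, ?_⟩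
  · intro S hS v hv
    suffices H : 0 ≤ (game R L hL).utility v S ∧ ∀ S' ∈ π.parts, S' ≠ S →
        (game R L hL).utility v S' ≤ (game R L hL).utility v S from
      ⟨H.1, fun S' hS' => if e : S' = S then by rw [e] else H.2 S' hS' e⟩
    have hS1 := hpart S hS v hv
    obtain ⟨t, i, ht, hi, rfl⟩ := exists_eq_vtx v
    simp only [ASHG.utility_eq_sum]
    rcases lt_or_ge i R with hiR | hiR
    · cases t with
      | zero => simp [weight_zero hL hiR]
      | succ t =>
        obtain ⟨w1, w2, w3, w4, w5⟩ := getD_wf hL ht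
        obtain ⟨h1, h2, -⟩ := hs t ht
        by_cases he : i = (L.getD (t + 1) default).tgt
        · subst he
          simp only [weight_tgt hL ht, Finset.sum_add_distrib, Finset.sum_ite_eq']
          refine ⟨by positivity, fun S' hS' hn => ?_⟩
          have d := hdisj S hS S' hS' hn
          -- One source shares the class, which pays at least 1; another class can contain only the
          -- other source and pays at most 1.
          have hm : vtx t (L.getD (t + 1) default).src₁ (by omega) (by omega) ∈ S ∨
              vtx t (L.getD (t + 1) default).src₂ (by omega) (by omega) ∈ S := by
            simp only [hS1, col]
            rw [color_vtx x _ w1, color_vtx x _ w2, color_vtx x _ w3]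
            exact h1.imp Eq.symm Eq.symm
          rcases hm with hm | hm
          · have := d _ hm
            simp only [hm, this, if_true, if_false]
            split_ifs <;> simp
          · have := d _ hm
            simp only [hm, this, if_true, if_false]
            split_ifs <;> simp
        · simp only [weight_copy hL ht hiR he, Finset.sum_ite_eq']
          have hm : vtx t i (by omega) (by omega) ∈ S := by
            simp only [hS1, col]
            rw [color_vtx x _ hiR, color_vtx x _ hiR, h2 _ he]
          refine ⟨by positivity, fun S' hS' hn => ?_⟩
          rw [if_pos hm]
          split_ifs <;> simp
    · obtain ⟨w1, w2, w3, w4, w5⟩ := getD_wf hL ht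
      rcases (by omega : i = R ∨ i = R + 1) with rfl | rfl
      · simp only [weight_check hL ht, Finset.sum_sub_distrib, Finset.sum_ite_eq']
        have m1 : vtx t (L.getD t default).lhs ht (by omega) ∈ S := by
          simp only [hS1, col]
          rw [color_vtx x _ w4, color_check]
        have m2 : vtx t (L.getD t default).rhs ht (by omega) ∉ S := by
          simp only [hS1, col]
          rw [color_vtx x _ w5, color_check]
          exact (hne' t ht).symm
        have m3 : vtx t (i + 1) ht (by omega) ∈ S := by
          simp only [hS1, col]
          rw [color_follow, color_check]
        -- The utility here is `1 - 0 - 1 = 0`, and every other class lacks the only liked vertex.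
        simp only [m1, m2, m3, if_true, if_false]
        refine ⟨by norm_num, fun S' hS' hn => ?_⟩
        simp only [hdisj S hS S' hS' hn _ m1, hdisj S hS S' hS' hn _ m3, if_false]
        split_ifs <;> simp
      · simp only [weight_follow hL ht, Finset.sum_ite_eq']
        have m1 : vtx t R ht (by omega) ∈ S := by
          simp only [hS1, col]
          rw [color_follow, color_check]
        refine ⟨by positivity, fun S' hS' hn => ?_⟩
        rw [if_pos m1]
        split_ifs <;> simp
  · intro S hS
    obtain ⟨v, hv⟩ := π.nonempty_of_mem_parts hS
    have hS1 := hpart S hS v hv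
    have hcol : ∀ u, col u < R := by
      intro u
      obtain ⟨t, i, ht, hi, rfl⟩ := exists_eq_vtx u
      simp only [col, color, vtx_div, vtx_mod]
      split_ifs with h
      · exact hlt t ht i h
      · exact hlt t ht _ (getD_wf hL ht).2.2.2.1
    have hroot : vtx 0 (col v) h0 (by have := hcol v; omega) ∈ S := by
      rw [hS1]
      simp only [col]
      rw [color_vtx x _ (hcol v), hx0]
    rw [SimpleGraph.connected_iff_exists_forall_reachable]
    refine ⟨⟨_, hroot⟩, ?_⟩
    have key : ∀ a (ha : a ∈ S), ∀ b (hb : b ∈ S), (game R L hL).weight b a ≠ 0 →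
        ((game R L hL).underlying.induce (S : Set _)).Reachable ⟨_, hroot⟩ ⟨a, ha⟩ →
        ((game R L hL).underlying.induce (S : Set _)).Reachable ⟨_, hroot⟩ ⟨b, hb⟩ := by
      intro a ha b hb hw hr
      refine hr.trans (SimpleGraph.Adj.reachable ?_)
      exact (adj_of_weight_ne _ hw).symm
    have reg : ∀ t (ht : t < L.length) i (hi : i < R) (hm : vtx t i ht (by omega) ∈ S),
        ((game R L hL).underlying.induce (S : Set _)).Reachable ⟨_, hroot⟩
          ⟨vtx t i ht (by omega), hm⟩ := by
      intro t
      induction t with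
      | zero =>
        intro ht i hi hm
        have e : i = col v := by
          have := (hS1 _).1 hm
          simp only [col] at this ⊢
          rwa [color_vtx x _ hi, hx0] at this
        subst e
        exact SimpleGraph.Reachable.refl _
      | succ t ih =>
        intro ht i hi hm
        obtain ⟨w1, w2, w3, w4, w5⟩ := getD_wf hL ht
        obtain ⟨h1, h2, -⟩ := hs t ht
        have hc := (hS1 _).1 hm
        simp only [col] at hc
        rw [color_vtx x _ hi] at hc
        by_cases he : i = (L.getD (t + 1) default).tgt
        · subst he
          rcases h1 with h1 | h1
          · have hm' : vtx t (L.getD (t + 1) default).src₁ (by omega) (by omega) ∈ S := by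
              simp only [hS1, col]
              rw [color_vtx x _ w2, ← h1, hc]
            refine key _ hm' _ hm ?_ (ih (by omega) _ w2 hm')
            rw [weight_tgt hL ht, if_pos rfl]
            positivity
          · have hm' : vtx t (L.getD (t + 1) default).src₂ (by omega) (by omega) ∈ S := by
              simp only [hS1, col]
              rw [color_vtx x _ w3, ← h1, hc]
            refine key _ hm' _ hm ?_ (ih (by omega) _ w3 hm')
            rw [weight_tgt hL ht, if_pos (c := vtx t (L.getD (t + 1) default).src₂ _ _ = _) rfl]
            positivity
        · have hm' : vtx t i (by omega) (by omega) ∈ S := by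
            simp only [hS1, col]
            rw [color_vtx x _ hi, ← h2 _ he, hc]
          refine key _ hm' _ hm ?_ (ih (by omega) _ hi hm')
          rw [weight_copy hL ht hi he, if_pos rfl]
          norm_num
    have chk : ∀ t (ht : t < L.length) (hm : vtx t R ht (by omega) ∈ S),
        ((game R L hL).underlying.induce (S : Set _)).Reachable ⟨_, hroot⟩
          ⟨vtx t R ht (by omega), hm⟩ := by
      intro t ht hm
      obtain ⟨w1, w2, w3, w4, w5⟩ := getD_wf hL ht
      have hc := (hS1 _).1 hm
      simp only [col] at hc
      rw [color_check] at hc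
      have hm' : vtx t (L.getD t default).lhs ht (by omega) ∈ S := by
        simp only [hS1, col]
        rw [color_vtx x _ w4, hc]
      refine key _ hm' _ hm ?_ (reg t ht _ w4 hm')
      have hne2 := hne' t ht
      rw [weight_check hL ht, if_pos rfl, if_neg, if_neg]
      · norm_num
      · rw [eq_vtx_iff, vtx_mod]
        omega
      · rw [eq_vtx_iff, vtx_mod]
        rintro ⟨-, e⟩
        rw [e] at hne2
        exact hne2 rfl
    rintro ⟨u, hu⟩
    obtain ⟨t, i, ht, hi, rfl⟩ := exists_eq_vtx u
    rcases lt_or_ge i R with hiR | hiR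
    · exact reg t ht i hiR hu
    rcases (by omega : i = R ∨ i = R + 1) with rfl | rfl
    · exact chk t ht hu
    · have hc := (hS1 _).1 hu
      simp only [col] at hc
      rw [color_follow] at hc
      have hm' : vtx t R ht (by omega) ∈ S := by
        simp only [hS1, col]
        rw [color_check, hc]
      refine key _ hm' _ hu ?_ (chk t ht hm')
      rw [weight_follow hL ht, if_pos rfl]
      norm_num

/-! #### Degree and pathwidth -/

theorem layer_of_adj {R : ℕ} {L : List Slot} (hL : ∀ c ∈ L, c.WF R)
    {u v : Fin (L.length * (R + 2))} (h : (game R L hL).graph.Adj u v) :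
    (u : ℕ) / (R + 2) = v / (R + 2) ∨ (u : ℕ) / (R + 2) = v / (R + 2) + 1 := by
  simp only [game, plus, minus] at h
  split_ifs at h <;> omega

/-- Arcs stay within a layer or lead to the previous one, so pairs of consecutive layers, with `2 *
(R + 2)` vertices at most, serve as bags. -/
theorem pathwidth_game_le {R : ℕ} {L : List Slot} (hL : ∀ c ∈ L, c.WF R) :
    pathwidth (game R L hL).underlying ≤ 2 * (R + 2) := by
  classical
  refine Nat.sInf_le ⟨⟨L.length, fun t => Finset.univ.filter fun u : Fin (L.length * (R + 2)) =>
    (u : ℕ) / (R + 2) = t ∨ (u : ℕ) / (R + 2) = t + 1, ?_, ?_, ?_⟩, ?_⟩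
  · exact fun v => ⟨⟨_, layer_lt v⟩, by simp⟩
  · rintro u v ⟨-, h | h⟩
    · exact ⟨⟨_, layer_lt v⟩, by simpa using layer_of_adj hL h⟩
    · exact ⟨⟨_, layer_lt u⟩, by simpa using layer_of_adj hL h⟩
  · intro v i j k hij hjk hi hk
    simp only [Finset.mem_filter, Finset.mem_univ, true_and, Fin.le_def] at *
    omega
  · intro t
    have hsub : (Finset.univ.filter fun u : Fin (L.length * (R + 2)) =>
        (u : ℕ) / (R + 2) = t ∨ (u : ℕ) / (R + 2) = t + 1).card ≤
        (Finset.range 2 ×ˢ Finset.range (R + 2)).card := by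
      refine Finset.card_le_card_of_injOn
        (fun u => ((u : ℕ) / (R + 2) - t, (u : ℕ) % (R + 2))) ?_ ?_
      · intro u hu
        have hm := Nat.mod_lt (u : ℕ) (by omega : R + 2 > 0)
        simp only [Finset.coe_filter, Finset.mem_univ, true_and, Set.mem_ofPred_eq] at hu
        simp only [Finset.coe_product, Finset.coe_range, Set.mem_prod, Set.mem_Iio]
        omega
      · intro u hu v hv he
        simp only [Finset.coe_filter, Finset.mem_univ, true_and, Set.mem_ofPred_eq] at hu hv
        simp only [Prod.mk.injEq] at he
        ext
        rw [← Nat.div_add_mod u (R + 2), ← Nat.div_add_mod v (R + 2), he.2]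
        congr 2
        omega
    simp only [Finset.card_product, Finset.card_range] at hsub
    exact hsub.trans (by omega)

theorem arc_cases {R : ℕ} {L : List Slot} {t i t' i' : ℕ}
    (h : plus R L t i t' i' + minus R L t i t' i' ≠ 0) :
    (t' = t ∧ (i = R ∨ i = R + 1) ∧ (i' = (L.getD t default).lhs ∨ i' = (L.getD t default).rhs ∨
      i' = R ∨ i' = R + 1)) ∨
    (t = t' + 1 ∧ (i' = i ∨ i = (L.getD t default).tgt ∧
      (i' = (L.getD t default).src₁ ∨ i' = (L.getD t default).src₂))) := by
  simp only [plus, minus] at h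
  split_ifs at h <;> omega

theorem maxDegree_game_le {R : ℕ} {L : List Slot} (hL : ∀ c ∈ L, c.WF R) :
    (game R L hL).maxDegree ≤ 10 := by
  classical
  unfold ASHG.maxDegree
  refine SimpleGraph.maxDegree_le_of_forall_degree_le _ _ fun v => ?_
  obtain ⟨t, i, ht, hi, rfl⟩ := exists_eq_vtx v
  -- All possible neighbours: the origins of the content in the previous layer, the two possible
  -- recipients in the next one, and within the layer the check vertex, its follower and its
  -- operands.
  let l : List (ℕ × ℕ) := [(t - 1, i), (t - 1, (L.getD t default).src₁),
    (t - 1, (L.getD t default).src₂), (t + 1, i), (t + 1, (L.getD (t + 1) default).tgt), (t, R),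
    (t, R + 1), (t, (L.getD t default).lhs), (t, (L.getD t default).rhs)]
  rw [← SimpleGraph.card_neighborFinset_eq_degree]
  calc _ ≤ l.toFinset.card := by
        refine Finset.card_le_card_of_injOn
          (fun u => ((u : ℕ) / (R + 2), (u : ℕ) % (R + 2))) ?_ ?_
        · intro u hu
          simp only [SimpleGraph.coe_neighborFinset, SimpleGraph.mem_neighborSet] at hu
          obtain ⟨s, j, hs, hj, rfl⟩ := exists_eq_vtx u
          simp only [List.coe_toFinset, Set.mem_ofPred_eq, vtx_div, vtx_mod]
          obtain ⟨-, hu | hu⟩ := hu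
          · simp only [game, vtx_div, vtx_mod] at hu
            rcases arc_cases hu with ⟨rfl, -, rfl | rfl | rfl | rfl⟩ |
              ⟨rfl, rfl | ⟨-, rfl | rfl⟩⟩ <;> simp [l]
          · simp only [game, vtx_div, vtx_mod] at hu
            rcases arc_cases hu with ⟨rfl, rfl | rfl, -⟩ | ⟨rfl, rfl | ⟨rfl, -⟩⟩ <;> simp [l]
        · intro u _ v _ he
          simp only [Prod.mk.injEq] at he
          ext
          rw [← Nat.div_add_mod u (R + 2), ← Nat.div_add_mod v (R + 2), he.2, he.1]
    _ ≤ l.length := List.toFinset_card_le _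
    _ ≤ 10 := by simp [l]

end Slot

/-! ### A register program for 3-SAT

The registers `j < M` hold pairwise different values, which stand for the assignments of a group of
variables; the register `M` holds a further value. The registers `M + 1` and `M + 2` are auxiliary,
and the register `M + 3 + i` holds the assignment of the `i`-th group. -/

namespace Slot

/-- The instruction that lets `r` be `p` or `q`. -/
def choose (M r p q : ℕ) : Slot := ⟨r, p, q, M, 0⟩

/-- The instruction that only asserts that `p` and `q` differ. -/
def assertNe (M p q : ℕ) : Slot := ⟨M, M, M, p, q⟩

/-- Choose the assignment of the `i`-th group. -/
def groupBlock (M i : ℕ) : List Slot :=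
  choose M (M + 3 + i) 0 0 :: (List.range M).map fun j => choose M (M + 3 + i) (M + 3 + i) j

/-- `0` if the digit of `j` with number `b` is `s`, and `1` otherwise (for `s ≤ 1`). -/
def mismatch (b s j : ℕ) : ℕ := (j / 2 ^ b % 2 - s) + (s - j / 2 ^ b % 2)

/-- The auxiliary register `M + 2` may become the assignment of the group of the variable `x`
if this assignment gives `x` the value `s`. -/
def literalBlock (l M x s : ℕ) : List Slot :=
  choose M (M + 1) M (M + 3 + x / l) ::
    (((List.range M).map fun j => assertNe M (M + mismatch (x % l) s j) j) ++
      [choose M (M + 2) (M + 2) (M + 1)])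

/-- Check a clause with the literals `(x e, s e)`, `e = 3 c, 3 c + 1, 3 c + 2`. -/
def clauseBlock (l M : ℕ) (x s : ℕ → ℕ) (c : ℕ) : List Slot :=
  choose M (M + 2) M M ::
    (((List.range 3).flatMap fun k => literalBlock l M (x (3 * c + k)) (s (3 * c + k))) ++
      [assertNe M (M + 2) M])

/-- The register program of a formula. -/
def satSlots (l M G m : ℕ) (x s : ℕ → ℕ) : List Slot :=
  (List.range G).flatMap (groupBlock M) ++ (List.range m).flatMap (clauseBlock l M x s)

/-! #### Well-formedness and length -/

theorem satSlots_wf {l M G m : ℕ} {x s : ℕ → ℕ} (hM : 0 < M) (hx : ∀ e < 3 * m, x e / l < G)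
    (hs : ∀ e < 3 * m, s e ≤ 1) : ∀ c ∈ satSlots l M G m x s, c.WF (M + 3 + G) := by
  intro c hc
  simp only [satSlots, groupBlock, clauseBlock, literalBlock, List.mem_append, List.mem_flatMap,
    List.mem_range, List.mem_cons, List.mem_map, List.not_mem_nil, or_false] at hc
  rcases hc with ⟨i, hi, rfl | ⟨j, hj, rfl⟩⟩ |
    ⟨c, hc, rfl | ⟨k, hk, rfl | ⟨j, hj, rfl⟩ | rfl⟩ | rfl⟩
  · simp only [WF, choose]; omega
  · simp only [WF, choose]; omega
  · simp only [WF, choose]; omega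
  · have := hx (3 * c + k) (by omega)
    simp only [WF, choose]; omega
  · have := hs (3 * c + k) (by omega)
    have : mismatch (x (3 * c + k) % l) (s (3 * c + k)) j ≤ 1 := by
      unfold mismatch; omega
    simp only [WF, assertNe]; omega
  · simp only [WF, choose]; omega
  · simp only [WF, assertNe]; omega

theorem length_satSlots (l M G m : ℕ) (x s : ℕ → ℕ) :
    (satSlots l M G m x s).length = G * (M + 1) + m * (3 * (M + 2) + 2) := by
  simp only [satSlots, groupBlock, clauseBlock, literalBlock, List.length_append,
    List.length_flatMap, List.length_cons, List.length_map, List.length_range, List.length_nil,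
    List.map_const', List.sum_replicate, smul_eq_mul]

/-! #### Runs yield satisfying assignments -/

section Sound

variable {α : Type*}

/-- The case of an instruction that copies `r` to itself is needed for `assertNe`, which formally
assigns the register `M` to itself. -/
theorem exec_frame {L : List Slot} {σ τ : ℕ → α} (h : Exec L σ τ) {r : ℕ}
    (hr : ∀ c ∈ L, c.tgt = r → c.src₁ = r ∧ c.src₂ = r) : τ r = σ r := by
  induction L generalizing σ with
  | nil => rw [show τ = σ from h]
  | cons c L ih =>
    obtain ⟨ρ, h1, h2⟩ := h
    rw [ih h2 fun c hc => hr c (List.mem_cons_of_mem _ hc)]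
    by_cases he : c.tgt = r
    · obtain ⟨e1, e2⟩ := hr c List.mem_cons_self he
      have := h1.1
      rwa [e1, e2, he, or_self] at this
    · exact h1.2.1 r (Ne.symm he)

theorem groupBlock_frame {M i r : ℕ} {σ τ : ℕ → α} (h : Exec (groupBlock M i) σ τ)
    (hr : r ≠ M + 3 + i) : τ r = σ r := by
  refine exec_frame h fun c hc he => ?_
  simp only [groupBlock, List.mem_cons, List.mem_map] at hc
  rcases hc with rfl | ⟨j, -, rfl⟩ <;> exact absurd he.symm hr

/-- The registers below `M` never change here, so the property of agreeing with one of them survives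
each further choice. -/
theorem groupBlock_sound {M i : ℕ} (hM : 0 < M) {σ τ : ℕ → α} (h : Exec (groupBlock M i) σ τ) :
    ∃ j < M, τ (M + 3 + i) = τ j := by
  obtain ⟨ρ, h1, h2⟩ := h
  have key : ∀ (js : List ℕ), (∀ j ∈ js, j < M) → ∀ ρ : ℕ → α, (∃ j < M, ρ (M + 3 + i) = ρ j) →
      Exec (js.map fun j => choose M (M + 3 + i) (M + 3 + i) j) ρ τ →
      ∃ j < M, τ (M + 3 + i) = τ j := by
    intro js
    induction js with
    | nil =>
      intro _ ρ hρ h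
      rwa [show τ = ρ from h]
    | cons j js ih =>
      intro hjs ρ ⟨j₀, hj₀, e⟩ ⟨ρ', h1, h2⟩
      refine ih (fun j hj => hjs j (List.mem_cons_of_mem _ hj)) ρ' ?_ h2
      have hf := h1.2.1
      have hj := hjs j List.mem_cons_self
      simp only [choose] at hf
      rcases h1.1 with h | h <;> simp only [choose] at h
      · exact ⟨j₀, hj₀, by rw [h, hf j₀ (by omega), e]⟩
      · exact ⟨j, hj, by rw [h, hf j (by omega)]⟩
  refine key _ (by simp) ρ ⟨0, hM, ?_⟩ h2
  have h0 := h1.1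
  have hf := h1.2.1 0 (by simp only [choose]; omega)
  simp only [choose, or_self] at h0
  rw [h0, hf]

theorem groupBlocks_sound {M G : ℕ} (hM : 0 < M) {σ τ : ℕ → α}
    (h : Exec ((List.range G).flatMap (groupBlock M)) σ τ) :
    ∀ i < G, ∃ j < M, τ (M + 3 + i) = τ j := by
  induction G generalizing τ with
  | zero => intro i hi; omega
  | succ G ih =>
    rw [List.range_succ, List.flatMap_append, exec_append] at h
    obtain ⟨ρ, h1, h2⟩ := h
    simp only [List.flatMap_cons, List.flatMap_nil, List.append_nil] at h2
    intro i hi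
    rcases Nat.lt_succ_iff_lt_or_eq.1 hi with hi | rfl
    · obtain ⟨j, hj, e⟩ := ih h1 i hi
      refine ⟨j, hj, ?_⟩
      rw [groupBlock_frame h2 (by omega), groupBlock_frame h2 (by omega), e]
    · exact groupBlock_sound hM h2

theorem literalBlock_frame {l M x s r : ℕ} {σ τ : ℕ → α} (h : Exec (literalBlock l M x s) σ τ)
    (h1 : r ≠ M + 1) (h2 : r ≠ M + 2) : τ r = σ r := by
  refine exec_frame h fun c hc he => ?_
  simp only [literalBlock, List.mem_cons, List.mem_append, List.mem_map, List.not_mem_nil,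
    or_false] at hc
  rcases hc with rfl | ⟨j, -, rfl⟩ | rfl
  · exact absurd he.symm h1
  · exact ⟨he, he⟩
  · exact absurd he.symm h2

theorem clauseBlock_frame {l M r c : ℕ} {x s : ℕ → ℕ} {σ τ : ℕ → α}
    (h : Exec (clauseBlock l M x s c) σ τ) (h1 : r ≠ M + 1) (h2 : r ≠ M + 2) : τ r = σ r := by
  refine exec_frame h fun c hc he => ?_
  simp only [clauseBlock, literalBlock, List.mem_cons, List.mem_append, List.mem_map,
    List.mem_flatMap, List.not_mem_nil, or_false] at hc
  rcases hc with rfl | ⟨k, -, rfl | ⟨j, -, rfl⟩ | rfl⟩ | rfl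
  · exact absurd he.symm h2
  · exact absurd he.symm h1
  · exact ⟨he, he⟩
  · exact absurd he.symm h2
  · exact ⟨he, he⟩

/-- The contents of the registers do not exclude that the literal `(x, s)` is true. -/
def Admits (l M x s : ℕ) (σ : ℕ → α) : Prop :=
  ∀ j < M, mismatch (x % l) s j = 1 → σ (M + 3 + x / l) ≠ σ j

theorem admits_congr {l M x s : ℕ} {σ τ : ℕ → α}
    (h : ∀ r, r ≠ M + 1 → r ≠ M + 2 → τ r = σ r) : Admits l M x s τ ↔ Admits l M x s σ := by
  unfold Admits
  generalize x / l = g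
  refine forall₂_congr fun j hj => ?_
  rw [h (M + 3 + g) (by omega) (by omega), h j (by omega) (by omega)]

theorem assertNes_sound {M : ℕ} {σ τ : ℕ → α} {f : ℕ → ℕ} {js : List ℕ}
    (h : Exec (js.map fun j => assertNe M (f j) j) σ τ) :
    τ = σ ∧ ∀ j ∈ js, σ (f j) ≠ σ j := by
  induction js generalizing σ with
  | nil => exact ⟨h, by simp⟩
  | cons j js ih =>
    obtain ⟨ρ, h1, h2⟩ := h
    have e : ρ = σ := by
      funext r
      by_cases hr : r = M
      · subst hr
        simpa [assertNe] using h1.1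
      · exact h1.2.1 r hr
    subst e
    obtain ⟨e, h3⟩ := ih h2
    refine ⟨e, ?_⟩
    simp only [List.mem_cons, forall_eq_or_imp]
    exact ⟨h1.2.2, h3⟩

/-- A new value of `M + 2` comes from `M + 1`, which holds either the neutral value of `M` or the
guess for the group. In the latter case the assertions of the block amount to `Admits`; where
`mismatch` is 0 they only compare `M` with `j`. -/
theorem literalBlock_sound {l M x s : ℕ} {σ τ : ℕ → α} (h : Exec (literalBlock l M x s) σ τ) :
    τ (M + 2) = σ (M + 2) ∨ τ (M + 2) = σ M ∨ Admits l M x s σ := by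
  obtain ⟨ρ, h1, h2⟩ := h
  obtain ⟨ρ', h2, h3⟩ := exec_append.1 h2
  obtain ⟨rfl, h2⟩ := assertNes_sound h2
  obtain ⟨τ', h3, rfl⟩ := h3
  have hf := h1.2.1
  have hv := h1.1
  have hw := h3.1
  simp only [choose] at hf hv hw
  rcases hw with hw | hw
  · left
    rw [hw, hf _ (by omega)]
  · rcases hv with hv | hv
    · right; left
      rw [hw, hv]
    · right; right
      intro j hj hm
      have := h2 j (List.mem_range.2 hj)
      rw [hm, hv, hf j (by omega)] at this
      exact this

/-- The register `M + 2` starts with the neutral value and must end with another one, so some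
literal block has brought in the guess for a group, which requires `Admits`. -/
theorem clauseBlock_sound {l M c : ℕ} {x s : ℕ → ℕ} {σ τ : ℕ → α}
    (h : Exec (clauseBlock l M x s c) σ τ) :
    ∃ k < 3, Admits l M (x (3 * c + k)) (s (3 * c + k)) σ := by
  obtain ⟨ρ, h1, h2⟩ := h
  obtain ⟨ρ', h2, τ', h3, rfl⟩ := exec_append.1 h2
  have hf := h1.2.1
  have hw := h1.1
  simp only [choose, or_self] at hf hw
  have key : ∀ n ρ', Exec ((List.range n).flatMap fun k =>
      literalBlock l M (x (3 * c + k)) (s (3 * c + k))) ρ ρ' →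
      (∀ r, r ≠ M + 1 → r ≠ M + 2 → ρ' r = σ r) ∧
      (ρ' (M + 2) = σ M ∨ ∃ k < n, Admits l M (x (3 * c + k)) (s (3 * c + k)) σ) := by
    intro n
    induction n with
    | zero =>
      intro ρ' h
      rw [show ρ' = ρ from h]
      exact ⟨fun r _ hr => hf r hr, Or.inl hw⟩
    | succ n ih =>
      intro ρ' h
      rw [List.range_succ, List.flatMap_append, exec_append] at h
      obtain ⟨κ, h1, h2⟩ := h
      simp only [List.flatMap_cons, List.flatMap_nil, List.append_nil] at h2
      obtain ⟨i1, i2⟩ := ih κ h1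
      refine ⟨fun r hr hr' => by rw [literalBlock_frame h2 hr hr', i1 r hr hr'], ?_⟩
      rcases literalBlock_sound h2 with h | h | h
      · rw [h]
        exact i2.imp_right fun ⟨k, hk, h⟩ => ⟨k, hk.trans (by omega), h⟩
      · rw [h, i1 M (by omega) (by omega)]
        exact Or.inl rfl
      · exact Or.inr ⟨n, by omega, (admits_congr i1).1 h⟩
  obtain ⟨i1, i2⟩ := key 3 ρ' h2
  refine i2.resolve_left fun e => ?_
  have h4 := h3.2.2
  have h5 := h3.2.1
  have h6 := h3.1
  simp only [assertNe, or_self] at h4 h5 h6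
  rw [h5 (M + 2) (by omega), h6, e, i1 M (by omega) (by omega)] at h4
  exact h4 rfl

/-- The registers `j < M` need not have different contents: `val i` is any `j` with the content of
the group register, and the assertions passed by that content rule out that this `j` falsifies the
literal. -/
theorem satSlots_sound {l M G m : ℕ} {x s : ℕ → ℕ} (hM : 0 < M)
    (hx : ∀ e < 3 * m, x e / l < G) {σ τ : ℕ → α} (h : Exec (satSlots l M G m x s) σ τ) :
    ∃ val : ℕ → ℕ, ∀ c < m, ∃ k < 3,
      mismatch (x (3 * c + k) % l) (s (3 * c + k)) (val (x (3 * c + k) / l)) ≠ 1 := by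
  obtain ⟨ρ, h1, h2⟩ := exec_append.1 h
  have hg := groupBlocks_sound hM h1
  choose! val hval using hg
  have key : ∀ n ≤ m, ∀ τ, Exec ((List.range n).flatMap (clauseBlock l M x s)) ρ τ →
      (∀ r, r ≠ M + 1 → r ≠ M + 2 → τ r = ρ r) ∧
      ∀ c < n, ∃ k < 3, Admits l M (x (3 * c + k)) (s (3 * c + k)) ρ := by
    intro n
    induction n with
    | zero =>
      intro _ τ h
      rw [show τ = ρ from h]
      simp
    | succ n ih =>
      intro hn τ h
      rw [List.range_succ, List.flatMap_append, exec_append] at h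
      obtain ⟨κ, h1, h2⟩ := h
      simp only [List.flatMap_cons, List.flatMap_nil, List.append_nil] at h2
      obtain ⟨i1, i2⟩ := ih (by omega) κ h1
      refine ⟨fun r hr hr' => by rw [clauseBlock_frame h2 hr hr', i1 r hr hr'], ?_⟩
      intro c hc
      rcases Nat.lt_succ_iff_lt_or_eq.1 hc with hc | rfl
      · exact i2 c hc
      · obtain ⟨k, hk, h⟩ := clauseBlock_sound h2
        exact ⟨k, hk, (admits_congr i1).1 h⟩
  refine ⟨val, fun c hc => ?_⟩
  obtain ⟨k, hk, h⟩ := (key m le_rfl τ h2).2 c hc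
  refine ⟨k, hk, fun hm => ?_⟩
  obtain ⟨v1, v2⟩ := hval _ (hx (3 * c + k) (by omega))
  exact h _ v1 hm v2

end Sound

/-! #### Satisfying assignments yield runs -/

/-- The second hypothesis is the idle assertion that the registers `M` and `0` differ, which
`choose` carries because every instruction asserts something. -/
theorem step_choose {M r p q : ℕ} {σ : ℕ → ℕ} {v : ℕ} (h : v = σ p ∨ v = σ q)
    (hM : Function.update σ r v M ≠ Function.update σ r v 0) :
    (choose M r p q).Step σ (Function.update σ r v) :=
  ⟨by simpa [choose] using h, fun i hi => Function.update_of_ne hi _ _, hM⟩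

theorem exec_assertNes {M : ℕ} {σ : ℕ → ℕ} {f : ℕ → ℕ} {js : List ℕ}
    (h : ∀ j ∈ js, σ (f j) ≠ σ j) : Exec (js.map fun j => assertNe M (f j) j) σ σ := by
  induction js with
  | nil => rfl
  | cons j js ih =>
    exact ⟨σ, ⟨by simp [assertNe], fun _ _ => rfl, h j List.mem_cons_self⟩,
      ih fun j hj => h j (List.mem_cons_of_mem _ hj)⟩

/-- The registers hold the values `val i` for the groups `i < G`. -/
def Holds (M G : ℕ) (val : ℕ → ℕ) (σ : ℕ → ℕ) : Prop :=
  (∀ j ≤ M, σ j = j) ∧ ∀ i < G, σ (M + 3 + i) = val i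

theorem Holds.update {M G r v : ℕ} {val σ : ℕ → ℕ} (h : Holds M G val σ)
    (hr : r = M + 1 ∨ r = M + 2) : Holds M G val (Function.update σ r v) := by
  refine ⟨fun j hj => ?_, fun i hi => ?_⟩
  · rw [Function.update_of_ne (by omega), h.1 j hj]
  · rw [Function.update_of_ne (by omega), h.2 i hi]

theorem exec_groupBlock {M i v : ℕ} {σ : ℕ → ℕ} (hσ : ∀ j ≤ M, σ j = j) (hv : v < M) :
    Exec (groupBlock M i) σ (Function.update σ (M + 3 + i) v) := by
  have hne : ∀ w, Function.update σ (M + 3 + i) w M ≠ Function.update σ (M + 3 + i) w 0 := by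
    intro w
    rw [Function.update_of_ne (by omega), Function.update_of_ne (by omega), hσ M le_rfl,
      hσ 0 (by omega)]
    omega
  refine ⟨Function.update σ (M + 3 + i) 0,
    step_choose (by rw [hσ 0 (by omega)]; simp) (hne _), ?_⟩
  -- The register keeps the default `0` until the option `v` is offered, and keeps `v` from then on.
  have key : ∀ k ≤ M, Exec ((List.range k).map fun j => choose M (M + 3 + i) (M + 3 + i) j)
      (Function.update σ (M + 3 + i) 0)
      (Function.update σ (M + 3 + i) (if v < k then v else 0)) := by
    intro k
    induction k with
    | zero => intro _; simp [Exec]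
    | succ k ih =>
      intro hk
      rw [List.range_succ, List.map_append, exec_append]
      refine ⟨_, ih (by omega), _, ?_, rfl⟩
      have h := step_choose (M := M) (r := M + 3 + i) (p := M + 3 + i) (q := k)
        (σ := Function.update σ (M + 3 + i) (if v < k then v else 0))
        (v := if v < k + 1 then v else 0) (by
          rw [Function.update_self, Function.update_of_ne (by omega), hσ k (by omega)]
          split_ifs <;> omega) (by rw [Function.update_idem]; exact hne _)
      rwa [Function.update_idem] at h
  have := key M le_rfl
  rwa [if_pos hv] at this

theorem exec_groupBlocks {M G : ℕ} {val : ℕ → ℕ} (hv : ∀ i, val i < M) :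
    ∃ τ, Exec ((List.range G).flatMap (groupBlock M)) id τ ∧ Holds M G val τ := by
  induction G with
  | zero => exact ⟨id, rfl, fun _ _ => rfl, by simp⟩
  | succ G ih =>
    obtain ⟨τ, h1, h2, h3⟩ := ih
    refine ⟨Function.update τ (M + 3 + G) (val G), ?_, ?_⟩
    · rw [List.range_succ, List.flatMap_append, exec_append]
      simp only [List.flatMap_cons, List.flatMap_nil, List.append_nil]
      exact ⟨τ, h1, exec_groupBlock h2 (hv G)⟩
    · refine ⟨fun j hj => ?_, fun i hi => ?_⟩
      · rw [Function.update_of_ne (by omega), h2 j hj]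
      · rcases Nat.lt_succ_iff_lt_or_eq.1 hi with hi | rfl
        · rw [Function.update_of_ne (by omega), h3 i hi]
        · rw [Function.update_self]

theorem exec_literalBlock {l M G x s : ℕ} {val σ : ℕ → ℕ} (hM : 0 < M) (hv : ∀ i, val i < M)
    (hσ : Holds M G val σ) (hx : x / l < G) (hs : s ≤ 1) :
    ∃ τ, Exec (literalBlock l M x s) σ τ ∧ Holds M G val τ ∧
      (σ (M + 2) ≠ M → τ (M + 2) ≠ M) ∧
      (mismatch (x % l) s (val (x / l)) = 0 → τ (M + 2) ≠ M) := by
  have hm : ∀ j, mismatch (x % l) s j = 0 ∨ mismatch (x % l) s j = 1 := by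
    intro j
    unfold mismatch
    omega
  have hne : ∀ τ : ℕ → ℕ, Holds M G val τ → τ M ≠ τ 0 := by
    intro τ h
    rw [h.1 M le_rfl, h.1 0 (by omega)]
    omega
  -- A true literal sends the guess through `M + 1` to `M + 2`. For a false one `M + 1` takes the
  -- neutral value, which passes all assertions, and `M + 2` is kept.
  by_cases hg : mismatch (x % l) s (val (x / l)) = 0
  · have h1 : Holds M G val (Function.update σ (M + 1) (val (x / l))) := hσ.update (Or.inl rfl)
    have h2 : Holds M G val (Function.update (Function.update σ (M + 1) (val (x / l))) (M + 2)
      (val (x / l))) := h1.update (Or.inr rfl)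
    refine ⟨_, ⟨_, step_choose (v := val (x / l)) (Or.inr (hσ.2 _ hx).symm) (hne _ h1),
      exec_append.2 ⟨_, exec_assertNes ?_, _, step_choose (v := val (x / l)) (Or.inr ?_)
        (hne _ h2), rfl⟩⟩, h2, ?_, ?_⟩
    · intro j hj
      have hj := List.mem_range.1 hj
      rw [h1.1 j (by omega)]
      rcases hm j with h | h
      · rw [h, add_zero, h1.1 M le_rfl]
        omega
      · rw [h, Function.update_self]
        rintro rfl
        omega
    · rw [Function.update_self]
    · intro _
      rw [Function.update_self]
      exact (hv _).ne
    · intro _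
      rw [Function.update_self]
      exact (hv _).ne
  · have h1 : Holds M G val (Function.update σ (M + 1) M) := hσ.update (Or.inl rfl)
    have h2 : Holds M G val (Function.update (Function.update σ (M + 1) M) (M + 2)
      (σ (M + 2))) := h1.update (Or.inr rfl)
    refine ⟨_, ⟨_, step_choose (v := M) (Or.inl (hσ.1 M le_rfl).symm) (hne _ h1),
      exec_append.2 ⟨_, exec_assertNes ?_, _, step_choose (v := σ (M + 2)) (Or.inl ?_)
        (hne _ h2), rfl⟩⟩, h2, ?_, ?_⟩
    · intro j hj
      have hj := List.mem_range.1 hj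
      rw [h1.1 j (by omega)]
      rcases hm j with h | h
      · rw [h, add_zero, h1.1 M le_rfl]
        omega
      · rw [h, Function.update_self]
        omega
    · rw [Function.update_of_ne (by omega)]
    · intro h
      rwa [Function.update_self]
    · intro h
      exact absurd h hg

theorem exec_clauseBlock {l M G c : ℕ} {x s val σ : ℕ → ℕ} (hM : 0 < M) (hv : ∀ i, val i < M)
    (hσ : Holds M G val σ) (hx : ∀ k < 3, x (3 * c + k) / l < G)
    (hs : ∀ k < 3, s (3 * c + k) ≤ 1)
    (hc : ∃ k < 3, mismatch (x (3 * c + k) % l) (s (3 * c + k)) (val (x (3 * c + k) / l)) = 0) :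
    ∃ τ, Exec (clauseBlock l M x s c) σ τ ∧ Holds M G val τ := by
  have h1 : Holds M G val (Function.update σ (M + 2) M) := hσ.update (Or.inr rfl)
  have key : ∀ n ≤ 3, ∃ τ, Exec ((List.range n).flatMap fun k =>
      literalBlock l M (x (3 * c + k)) (s (3 * c + k))) (Function.update σ (M + 2) M) τ ∧
      Holds M G val τ ∧ ((∃ k < n, mismatch (x (3 * c + k) % l) (s (3 * c + k))
        (val (x (3 * c + k) / l)) = 0) → τ (M + 2) ≠ M) := by
    intro n
    induction n with
    | zero => exact fun _ => ⟨_, rfl, h1, by simp⟩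
    | succ n ih =>
      intro hn
      obtain ⟨ρ, h2, h3, h4⟩ := ih (by omega)
      obtain ⟨τ, h5, h6, h7, h8⟩ := exec_literalBlock hM hv h3 (hx n hn) (hs n hn)
      refine ⟨τ, ?_, h6, ?_⟩
      · rw [List.range_succ, List.flatMap_append, exec_append]
        simp only [List.flatMap_cons, List.flatMap_nil, List.append_nil]
        exact ⟨ρ, h2, h5⟩
      · rintro ⟨k, hk, h⟩
        rcases Nat.lt_succ_iff_lt_or_eq.1 hk with hk | rfl
        · exact h7 (h4 ⟨k, hk, h⟩)
        · exact h8 h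
  obtain ⟨τ, h2, h3, h4⟩ := key 3 le_rfl
  refine ⟨τ, ⟨_, step_choose (v := M) (Or.inl (hσ.1 M le_rfl).symm) ?_,
    exec_append.2 ⟨τ, h2, τ, ⟨by simp [assertNe], fun _ _ => rfl, ?_⟩, rfl⟩⟩, h3⟩
  · rw [h1.1 M le_rfl, h1.1 0 (by omega)]
    omega
  · simp only [assertNe]
    rw [h3.1 M le_rfl]
    exact h4 hc

theorem exists_exec_satSlots {l M G m : ℕ} {x s val : ℕ → ℕ} (hM : 0 < M)
    (hv : ∀ i, val i < M) (hx : ∀ e < 3 * m, x e / l < G) (hs : ∀ e < 3 * m, s e ≤ 1)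
    (hc : ∀ c < m, ∃ k < 3,
      mismatch (x (3 * c + k) % l) (s (3 * c + k)) (val (x (3 * c + k) / l)) = 0) :
    ∃ τ, Exec (satSlots l M G m x s) id τ := by
  obtain ⟨ρ, h1, h2⟩ := exec_groupBlocks (G := G) hv
  have key : ∀ n ≤ m, ∃ τ, Exec ((List.range n).flatMap (clauseBlock l M x s)) ρ τ ∧
      Holds M G val τ := by
    intro n
    induction n with
    | zero => exact fun _ => ⟨_, rfl, h2⟩
    | succ n ih =>
      intro hn
      obtain ⟨κ, h3, h4⟩ := ih (by omega)
      obtain ⟨τ, h5, h6⟩ := exec_clauseBlock hM hv h4 (fun k hk => hx (3 * n + k) (by omega))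
        (fun k hk => hs (3 * n + k) (by omega)) (hc n hn)
      refine ⟨τ, ?_, h6⟩
      rw [List.range_succ, List.flatMap_append, exec_append]
      simp only [List.flatMap_cons, List.flatMap_nil, List.append_nil]
      exact ⟨κ, h3, h5⟩
  obtain ⟨τ, h3, -⟩ := key m le_rfl
  exact ⟨τ, exec_append.2 ⟨ρ, h1, h3⟩⟩

end Slot

/-! #### The program of a formula -/

theorem getD_flatMap_ofFn {α : Type*} (L : List α) (f : α → Fin 3 → ℕ) (i : ℕ) (hi : i < L.length)
    (k : Fin 3) : (L.flatMap fun a => List.ofFn (f a)).getD (3 * i + k) 0 = f L[i] k := by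
  induction L generalizing i with
  | nil => simp at hi
  | cons a L ih =>
    rw [List.flatMap_cons]
    cases i with
    | zero =>
      rw [List.getD_append _ _ _ _ (by simp)]
      fin_cases k <;> simp
    | succ i =>
      rw [List.getD_append_right _ _ _ _ (by simp; omega)]
      have := ih i (by simpa using hi)
      simpa [show 3 * (i + 1) + (k : ℕ) - 3 = 3 * i + k by omega] using this

namespace ThreeCNF

variable {n : ℕ} (φ : ThreeCNF n)

/-- The variable of the literal with number `e`. -/
def litVar (e : ℕ) : ℕ := (φ.flatMap fun c => List.ofFn fun k => ((c k).1 : ℕ)).getD e 0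

/-- The sign of the literal with number `e`. -/
def litSign (e : ℕ) : ℕ := (φ.flatMap fun c => List.ofFn fun k => (c k).2.toNat).getD e 0

theorem litVar_eq {i : ℕ} (hi : i < φ.length) (k : Fin 3) :
    φ.litVar (3 * i + k) = (φ[i] k).1 :=
  getD_flatMap_ofFn φ (fun c k => ((c k).1 : ℕ)) i hi k

theorem litSign_eq {i : ℕ} (hi : i < φ.length) (k : Fin 3) :
    φ.litSign (3 * i + k) = (φ[i] k).2.toNat :=
  getD_flatMap_ofFn φ (fun c k => (c k).2.toNat) i hi k

theorem litVar_lt {e : ℕ} (he : e < 3 * φ.length) : φ.litVar e < n := by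
  have := φ.litVar_eq (i := e / 3) (by omega) ⟨e % 3, by omega⟩
  simp only [Nat.div_add_mod] at this
  rw [this]
  exact Fin.is_lt _

theorem litSign_le {e : ℕ} (he : e < 3 * φ.length) : φ.litSign e ≤ 1 := by
  have := φ.litSign_eq (i := e / 3) (by omega) ⟨e % 3, by omega⟩
  simp only [Nat.div_add_mod] at this
  rw [this]
  exact Bool.toNat_le _

/-- The number of variables per group. -/
def groupSize (n : ℕ) : ℕ := Nat.log 4 n + 1

/-- The register program of a formula. -/
def slots : List Slot :=
  -- Layer 0 performs no transition, so an instruction without effect occupies it.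
  Slot.assertNe (2 ^ groupSize n) (2 ^ groupSize n) 0 ::
    Slot.satSlots (groupSize n) (2 ^ groupSize n) (n / groupSize n + 1) φ.length
      φ.litVar φ.litSign

/-- The number of registers. -/
def numRegs (n : ℕ) : ℕ := 2 ^ groupSize n + 3 + (n / groupSize n + 1)

theorem slots_wf : ∀ c ∈ φ.slots, c.WF (numRegs n) := by
  have hM : 0 < 2 ^ groupSize n := by positivity
  intro c hc
  rcases List.mem_cons.1 hc with rfl | hc
  · simp only [Slot.WF, Slot.assertNe, numRegs]
    generalize n / groupSize n = g
    omega
  · refine Slot.satSlots_wf hM (fun e he => ?_) (fun e he => φ.litSign_le he) c hc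
    exact Nat.lt_succ_of_le (Nat.div_le_div_right (φ.litVar_lt he).le)

theorem mismatch_eq_zero_iff {b j : ℕ} {s : Bool} :
    Slot.mismatch b s.toNat j = 0 ↔ j.testBit b = s := by
  rw [Nat.testBit_eq_decide_div_mod_eq]
  unfold Slot.mismatch
  have := Nat.mod_two_eq_zero_or_one (j / 2 ^ b)
  cases s <;> simp only [Bool.toNat_true, Bool.toNat_false, decide_eq_true_iff,
    decide_eq_false_iff_not] <;> omega

theorem mismatch_le {b j s : ℕ} (hs : s ≤ 1) : Slot.mismatch b s j ≤ 1 := by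
  unfold Slot.mismatch
  omega

theorem exists_connectedNashStable_of_satisfiable (h : φ.Satisfiable) :
    ∃ π : Finpartition (Finset.univ : Finset (Fin (φ.slots.length * (numRegs n + 2)))),
      (Slot.game (numRegs n) φ.slots φ.slots_wf).ConnectedNashStable π := by
  obtain ⟨σ, hσ⟩ := h
  have hM : 0 < 2 ^ groupSize n := by positivity
  let σ' : ℕ → Bool := fun i => if h : i < n then σ ⟨i, h⟩ else false
  -- Bit `b` of `val i` is the value of the variable `i * groupSize n + b`; the last group may be
  -- incomplete, which is why `σ'` is padded with `false`.
  let val : ℕ → ℕ := fun i => Nat.ofBits fun b : Fin (groupSize n) => σ' (i * groupSize n + b)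
  have hbit : ∀ x : Fin n, (val (x / groupSize n)).testBit (x % groupSize n) = σ x := by
    intro x
    have hb : (x : ℕ) % groupSize n < groupSize n := Nat.mod_lt _ (by unfold groupSize; omega)
    simp only [val, Nat.testBit_ofBits_lt _ _ hb, Nat.div_add_mod', σ', x.2, dif_pos]
  obtain ⟨τ, hτ⟩ := Slot.exists_exec_satSlots (l := groupSize n) (G := n / groupSize n + 1)
    (m := φ.length) (x := φ.litVar) (s := φ.litSign) (val := val) hM
    (fun i => Nat.ofBits_lt_two_pow _)
    (fun e he => Nat.lt_succ_of_le (Nat.div_le_div_right (φ.litVar_lt he).le))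
    (fun e he => φ.litSign_le he) (fun c hc => by
      obtain ⟨k, hk⟩ := hσ φ[c] (List.getElem_mem hc)
      refine ⟨k, k.2, ?_⟩
      rw [φ.litVar_eq hc, φ.litSign_eq hc, mismatch_eq_zero_iff, hbit, hk])
  obtain ⟨y, hy0, hy⟩ := Slot.steps_of_exec hτ
  refine Slot.exists_connectedNashStable φ.slots_wf (by simp [slots]) y (fun i => by rw [hy0]; rfl)
    (fun t ht => ?_) ?_
  · simpa [slots] using hy t (by simpa [slots] using ht)
  · simp [slots, Slot.assertNe]

theorem satisfiable_of_nashStable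
    {π : Finpartition (Finset.univ : Finset (Fin (φ.slots.length * (numRegs n + 2))))}
    (h : (Slot.game (numRegs n) φ.slots φ.slots_wf).NashStable π) : φ.Satisfiable := by
  obtain ⟨y, hy⟩ := Slot.exists_run_of_nashStable φ.slots_wf h
  have hM : 0 < 2 ^ groupSize n := by positivity
  -- Instruction `t` of the tail is instruction `t + 1` of the program, which leads from layer `t`
  -- to layer `t + 1`.
  have hex := Slot.exec_of_steps (x := y) (L := φ.slots.tail) fun t ht => by
    simpa [slots] using hy t (by simpa [slots] using ht)
  obtain ⟨val, hval⟩ := Slot.satSlots_sound hM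
    (fun e he => Nat.lt_succ_of_le (Nat.div_le_div_right (φ.litVar_lt he).le)) hex
  refine ⟨fun x => (val (x / groupSize n)).testBit (x % groupSize n), fun c hc => ?_⟩
  obtain ⟨i, hi, rfl⟩ := List.getElem_of_mem hc
  obtain ⟨k, hk, h⟩ := hval i hi
  refine ⟨⟨k, hk⟩, ?_⟩
  rw [← mismatch_eq_zero_iff, ← φ.litVar_eq hi, ← φ.litSign_eq hi]
  have := mismatch_le (b := φ.litVar (3 * i + k) % groupSize n)
    (j := val (φ.litVar (3 * i + k) / groupSize n)) (φ.litSign_le (e := 3 * i + k) (by omega))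
  simp only
  omega

theorem exists_connectedNashStable_iff :
    (∃ π : Finpartition (Finset.univ : Finset (Fin (φ.slots.length * (numRegs n + 2)))),
      (Slot.game (numRegs n) φ.slots φ.slots_wf).ConnectedNashStable π) ↔ φ.Satisfiable :=
  ⟨fun ⟨_, h⟩ => φ.satisfiable_of_nashStable h.1, φ.exists_connectedNashStable_of_satisfiable⟩

end ThreeCNF

/-! ### Reasoning about random access machines -/

namespace RAM

theorem Store.set_apply (s : Store) (a i x b j : ℕ) :
    (s.set a i x) b j = if b = a ∧ j = i then x else s b j := by
  unfold Store.set
  by_cases h : b = a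
  · subst h
    by_cases h' : j = i <;> simp [h']
  · simp [h]

theorem Store.set_of_ne (s : Store) {a b : ℕ} (i x : ℕ) (h : b ≠ a) : (s.set a i x) b = s b :=
  Function.update_of_ne h _ _

/-- The arrays that an expression may read. -/
def Expr.reads : Expr → List ℕ
  | const _ => []
  | read a i => a :: i.reads
  | add e₁ e₂ => e₁.reads ++ e₂.reads
  | sub e₁ e₂ => e₁.reads ++ e₂.reads

theorem Expr.eval_congr {s s' : Store} {e : Expr} (h : ∀ a ∈ e.reads, s' a = s a) :
    e.eval s' = e.eval s := by
  induction e with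
  | const n => rfl
  | read a i ih =>
    simp only [reads, List.mem_cons, forall_eq_or_imp] at h
    simp only [eval, ih h.2, h.1]
  | add e₁ e₂ ih₁ ih₂ =>
    simp only [reads, List.mem_append] at h
    simp only [eval, ih₁ fun a ha => h a (Or.inl ha), ih₂ fun a ha => h a (Or.inr ha)]
  | sub e₁ e₂ ih₁ ih₂ =>
    simp only [reads, List.mem_append] at h
    simp only [eval, ih₁ fun a ha => h a (Or.inl ha), ih₂ fun a ha => h a (Or.inr ha)]

/-- The arrays that a program may change. -/
def Prog.writes : Prog → List ℕ
  | skip => []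
  | write a _ _ => [a]
  | seq P Q => P.writes ++ Q.writes
  | ite _ P Q => P.writes ++ Q.writes
  | loop _ P => P.writes

/-- Array names are static, only cell addresses are computed. So the preservation of an array is a
syntactic condition that can be decided. -/
theorem Runs.frame {P : Prog} {s s' : Store} {t : ℕ} (h : Runs P s t s') {a : ℕ}
    (ha : a ∉ P.writes) : s' a = s a := by
  induction h with
  | skip => rfl
  | write b i e s =>
    simp only [Prog.writes, List.mem_singleton] at ha
    exact s.set_of_ne _ _ ha
  | seq _ _ ih₁ ih₂ =>
    simp only [Prog.writes, List.mem_append, not_or] at ha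
    rw [ih₂ ha.2, ih₁ ha.1]
  | ite_true _ _ ih =>
    simp only [Prog.writes, List.mem_append, not_or] at ha
    exact ih ha.1
  | ite_false _ _ ih =>
    simp only [Prog.writes, List.mem_append, not_or] at ha
    exact ih ha.2
  | loop_true _ _ _ ih₁ ih₂ => rw [ih₂ ha, ih₁ ha]
  | loop_false => rfl

/-! ### Total correctness with time bounds -/

/-- Started on `s`, the program `P` halts within `T` steps with a memory that satisfies `Q`. -/
def WP (P : Prog) (s : Store) (T : ℕ) (Q : Store → Prop) : Prop :=
  ∃ t s', Runs P s t s' ∧ t ≤ T ∧ Q s'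

namespace WP

variable {P P' : Prog} {s : Store} {T T' : ℕ} {Q Q' : Store → Prop}

theorem mono (h : WP P s T Q) (hT : T ≤ T') (hQ : ∀ s', Q s' → Q' s') : WP P s T' Q' := by
  obtain ⟨t, s', h1, h2, h3⟩ := h
  exact ⟨t, s', h1, h2.trans hT, hQ _ h3⟩

theorem frame (h : WP P s T Q) : WP P s T fun s' => Q s' ∧ ∀ a, a ∉ P.writes → s' a = s a := by
  obtain ⟨t, s', h1, h2, h3⟩ := h
  exact ⟨t, s', h1, h2, h3, fun a ha => h1.frame ha⟩

theorem seq (h : WP P s T Q) (h' : ∀ s', Q s' → WP P' s' T' Q') :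
    WP (P.seq P') s (T + T') Q' := by
  obtain ⟨t, s', h1, h2, h3⟩ := h
  obtain ⟨t', s'', h4, h5, h6⟩ := h' s' h3
  exact ⟨_, s'', h1.seq h4, by omega, h6⟩

theorem write {a : ℕ} {i e : Expr} (h : Q (s.set a (i.eval s) (e.eval s))) :
    WP (.write a i e) s (i.cost + e.cost + 1) Q :=
  ⟨_, _, Runs.write a i e s, le_rfl, h⟩

/-- An invariant indexed by the number of completed rounds, with `N` known in advance, yields
termination and the time bound together. -/
theorem loop {e : Expr} {N : ℕ} (I : ℕ → Store → Prop) (h0 : I 0 s)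
    (hN : ∀ s, I N s → e.eval s = 0) (hlt : ∀ k < N, ∀ s, I k s → e.eval s ≠ 0)
    (hstep : ∀ k < N, ∀ s, I k s → WP P s T (I (k + 1))) :
    WP (.loop e P) s (N * (T + e.cost + 1) + e.cost + 1) (I N) := by
  have key : ∀ d k, k + d = N → ∀ s, I k s →
      WP (.loop e P) s (d * (T + e.cost + 1) + e.cost + 1) (I N) := by
    intro d
    induction d with
    | zero =>
      rintro k rfl s hs
      exact ⟨_, s, Runs.loop_false (hN s hs), by omega, hs⟩
    | succ d ih =>
      intro k hk s hs
      obtain ⟨t, s', h1, h2, h3⟩ := hstep k (by omega) s hs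
      obtain ⟨t', s'', h4, h5, h6⟩ := ih (k + 1) (by omega) s' h3
      refine ⟨_, s'', Runs.loop_true (hlt k (by omega) s hs) h1 h4, ?_, h6⟩
      rw [Nat.succ_mul]
      omega
  exact key N 0 (by omega) s h0

end WP

/-! ### Scalars, counting loops and division -/

/-- The scalar variable `a`: cell `0` of the array `a`. -/
def sc (a : ℕ) : Expr := .read a (.const 0)

/-- An assignment to a scalar variable. -/
def asg (a : ℕ) (e : Expr) : Prog := .write a (.const 0) e

@[simp] theorem eval_sc (a : ℕ) (s : Store) : (sc a).eval s = s a 0 := rfl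

@[simp] theorem cost_sc (a : ℕ) : (sc a).cost = 2 := rfl

theorem WP.asg {a : ℕ} {e : Expr} {s : Store} {Q : Store → Prop} (h : Q (s.set a 0 (e.eval s))) :
    WP (asg a e) s (e.cost + 2) Q :=
  (WP.write (i := .const 0) h).mono (by simp only [Expr.cost]; omega) fun _ h => h

/-- Execute `P` for `i = 0, …, e - 1`. -/
def forLoop (i : ℕ) (e : Expr) (P : Prog) : Prog :=
  (asg i (.const 0)).seq (.loop (.sub e (sc i)) (P.seq (asg i (.add (sc i) (.const 1)))))

/-- The bound `e` is evaluated anew in every round, so the invariant has to determine its value. The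
frame condition of the body is handed to the step, which carries unchanged data along. The overhead
10 comprises the test and the increment. -/
theorem WP.forLoop {i : ℕ} {e : Expr} {P : Prog} {s : Store} {T N : ℕ} (I : ℕ → Store → Prop)
    (hi : i ∉ P.writes) (h0 : I 0 (s.set i 0 0))
    (he : ∀ k, ∀ s, I k s → e.eval s = N)
    (hstep : ∀ k < N, ∀ s, I k s → s i 0 = k →
      WP P s T fun s' => (∀ a, a ∉ P.writes → s' a = s a) → I (k + 1) (s'.set i 0 (k + 1))) :
    WP (forLoop i e P) s (N * (T + e.cost + 10) + e.cost + 10) (I N) := by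
  have h1 : WP (.loop (.sub e (sc i)) (P.seq (RAM.asg i (.add (sc i) (.const 1)))))
      (s.set i 0 0) (N * (T + 6 + (Expr.sub e (sc i)).cost + 1) + (Expr.sub e (sc i)).cost + 1)
      fun s => I N s ∧ s i 0 = N := by
    refine WP.loop (N := N) (T := T + 6) (fun k s => I k s ∧ s i 0 = k)
      ⟨h0, by simp [Store.set_apply]⟩ ?_ ?_ ?_
    · rintro s ⟨hs, hk⟩
      simp [Expr.eval, he _ s hs, hk]
    · rintro k hk s ⟨hs, hk'⟩
      simp only [Expr.eval, he _ s hs, eval_sc, hk']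
      omega
    · rintro k hk s ⟨hs, hk'⟩
      refine ((hstep k hk s hs hk').frame).seq fun s' ⟨h1, h2⟩ => ?_
      refine (WP.asg ?_).mono (by simp [Expr.cost]) fun _ h => h
      have e1 : s' i 0 = k := by rw [h2 i hi, hk']
      simp only [Expr.eval, eval_sc, e1]
      exact ⟨h1 h2, by simp [Store.set_apply]⟩
  refine ((WP.asg (Q := fun s' => s' = s.set i 0 0) rfl).seq fun s' hs' => hs' ▸ h1).mono ?_
    fun s' h => h.1
  simp only [Expr.cost, cost_sc]
  have : N * (T + 6 + (e.cost + 2 + 1) + 1) = N * (T + e.cost + 10) := by ring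
  omega

/-- Division with remainder: `q := e / d` and `r := e % d`. -/
def divMod (q r : ℕ) (e d : Expr) : Prog :=
  (asg r e).seq ((asg q (.const 0)).seq
    (.loop (.sub (.add (sc r) (.const 1)) d)
      ((asg r (.sub (sc r) d)).seq (asg q (.add (sc q) (.const 1))))))

/-- Repeated subtraction, continued while `d ≤ r`; time linear in the dividend suffices for a
polynomial bound. The divisor must not read `q` or `r`, for it is evaluated in every round. -/
theorem WP.divMod {q r : ℕ} {e d : Expr} {s : Store} (x y : ℕ) (hqr : q ≠ r)
    (hq : q ∉ d.reads) (hr : r ∉ d.reads) (hx : e.eval s = x) (hy : d.eval s = y) (hy0 : 0 < y) :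
    WP (divMod q r e d) s (x * (2 * d.cost + 20) + e.cost + d.cost + 20)
      fun s' => s' q 0 = x / y ∧ s' r 0 = x % y := by
  have hd : ∀ s' : Store, (∀ a, a ≠ q → a ≠ r → s' a = s a) → d.eval s' = y := by
    intro s' h
    rw [← hy]
    refine Expr.eval_congr fun a ha => h a ?_ ?_ <;> rintro rfl <;> contradiction
  have h1 : WP (.loop (.sub (.add (sc r) (.const 1)) d)
      ((RAM.asg r (.sub (sc r) d)).seq (RAM.asg q (.add (sc q) (.const 1)))))
      ((s.set r 0 x).set q 0 0) (x / y * (d.cost + 5 + 6 +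
        (Expr.sub (.add (sc r) (.const 1)) d).cost + 1) +
        (Expr.sub (.add (sc r) (.const 1)) d).cost + 1) fun s' => (∀ a, a ≠ q → a ≠ r → s' a = s a) ∧
        s' r 0 = x - (x / y) * y ∧ s' q 0 = x / y := by
    refine WP.loop (N := x / y) (T := (d.cost + 5) + 6)
      (fun k s' => (∀ a, a ≠ q → a ≠ r → s' a = s a) ∧ s' r 0 = x - k * y ∧ s' q 0 = k) ?_ ?_ ?_ ?_
    · refine ⟨fun a h1 h2 => ?_, ?_, ?_⟩
      · rw [Store.set_of_ne _ _ _ h1, Store.set_of_ne _ _ _ h2]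
      · simp [Store.set_apply, hqr.symm]
      · simp [Store.set_apply]
    · rintro s' ⟨h1, h2, h3⟩
      simp only [Expr.eval, eval_sc, h2, hd s' h1]
      have := Nat.div_add_mod' x y
      have := Nat.mod_lt x hy0
      omega
    · rintro k hk s' ⟨h1, h2, h3⟩
      simp only [Expr.eval, eval_sc, h2, hd s' h1]
      have h4 : (k + 1) * y ≤ x := (Nat.le_div_iff_mul_le hy0).1 hk
      rw [Nat.succ_mul] at h4
      omega
    · rintro k hk s' ⟨h1, h2, h3⟩
      refine WP.seq (Q := fun s'' => s'' = s'.set r 0 (x - (k + 1) * y))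
        ((WP.asg ?_).mono (by simp only [Expr.cost, cost_sc]; omega) fun _ h => h) ?_
      · simp only [Expr.eval, eval_sc, h2, hd s' h1, Nat.succ_mul, Nat.sub_sub]
      · rintro s'' rfl
        refine (WP.asg ?_).mono (by simp [Expr.cost]) fun _ h => h
        refine ⟨fun a h4 h5 => ?_, ?_, ?_⟩
        · rw [Store.set_of_ne _ _ _ h4, Store.set_of_ne _ _ _ h5, h1 a h4 h5]
        · simp [Store.set_apply, hqr.symm]
        · simp [Store.set_apply, Expr.eval, h3, hqr]
  refine ((WP.asg (Q := fun s' => s' = s.set r 0 x) (by rw [hx])).seq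
    fun s' hs' => (WP.asg (Q := fun s' => s' = (s.set r 0 x).set q 0 0) (by rw [hs']; rfl)).seq
      fun s'' hs'' => hs'' ▸ h1).mono ?_ fun s' h => ⟨h.2.2, ?_⟩
  · simp only [Expr.cost, cost_sc]
    have h2 : x / y ≤ x := Nat.div_le_self _ _
    have h3 := Nat.mul_le_mul_right (2 * d.cost + 20) h2
    have h4 : x / y * (d.cost + 5 + 6 + (2 + 1 + 1 + d.cost + 1) + 1) ≤
        x / y * (2 * d.cost + 20) := Nat.mul_le_mul_left _ (by omega)
    omega
  · rw [h.2.1]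
    have := Nat.div_add_mod' x y
    omega

/-! #### Renaming the arrays of a program -/

/-- The expression in which every array name is increased by `K`. -/
def Expr.shift (K : ℕ) : Expr → Expr
  | const n => const n
  | read a i => read (a + K) (i.shift K)
  | add e₁ e₂ => add (e₁.shift K) (e₂.shift K)
  | sub e₁ e₂ => sub (e₁.shift K) (e₂.shift K)

/-- The program in which every array name is increased by `K`. -/
def Prog.shift (K : ℕ) : Prog → Prog
  | skip => skip
  | write a i e => write (a + K) (i.shift K) (e.shift K)
  | seq P Q => seq (P.shift K) (Q.shift K)
  | ite e P Q => ite (e.shift K) (P.shift K) (Q.shift K)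
  | loop e P => loop (e.shift K) (P.shift K)

theorem Expr.cost_shift (K : ℕ) (e : Expr) : (e.shift K).cost = e.cost := by
  induction e with
  | const n => rfl
  | read a i ih => simp [shift, cost, ih]
  | add e₁ e₂ ih₁ ih₂ => simp [shift, cost, ih₁, ih₂]
  | sub e₁ e₂ ih₁ ih₂ => simp [shift, cost, ih₁, ih₂]

theorem Expr.eval_shift {K : ℕ} {s S : Store} (h : ∀ a, S (a + K) = s a) (e : Expr) :
    (e.shift K).eval S = e.eval s := by
  induction e with
  | const n => rfl
  | read a i ih => simp [shift, eval, ih, h]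
  | add e₁ e₂ ih₁ ih₂ => simp [shift, eval, ih₁, ih₂]
  | sub e₁ e₂ ih₁ ih₂ => simp [shift, eval, ih₁, ih₂]

/-- An arbitrary program can thus run beside the data of the translation: the lowest `K` arrays are
neither read nor written, and the running time is the same. -/
theorem Runs.shift {P : Prog} {s s' : Store} {t : ℕ} (h : Runs P s t s') (K : ℕ) {S : Store}
    (hS : ∀ a, S (a + K) = s a) : ∃ S', Runs (P.shift K) S t S' ∧ ∀ a, S' (a + K) = s' a := by
  induction h generalizing S with
  | skip => exact ⟨S, .skip S, hS⟩
  | write a i e s =>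
    refine ⟨S.set (a + K) (i.eval s) (e.eval s), ?_, fun b => ?_⟩
    · have := Runs.write (a + K) (i.shift K) (e.shift K) S
      rwa [Expr.cost_shift, Expr.cost_shift, Expr.eval_shift hS, Expr.eval_shift hS] at this
    · funext j
      simp [Store.set_apply, hS]
  | seq _ _ ih₁ ih₂ =>
    obtain ⟨S', h1, h2⟩ := ih₁ hS
    obtain ⟨S'', h3, h4⟩ := ih₂ h2
    exact ⟨S'', h1.seq h3, h4⟩
  | ite_true he _ ih =>
    obtain ⟨S', h1, h2⟩ := ih hS
    refine ⟨S', ?_, h2⟩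
    rw [← Expr.cost_shift K]
    exact Runs.ite_true (by rwa [Expr.eval_shift hS]) h1
  | ite_false he _ ih =>
    obtain ⟨S', h1, h2⟩ := ih hS
    refine ⟨S', ?_, h2⟩
    rw [← Expr.cost_shift K]
    exact Runs.ite_false (by rwa [Expr.eval_shift hS]) h1
  | loop_true he _ _ ih₁ ih₂ =>
    obtain ⟨S', h1, h2⟩ := ih₁ hS
    obtain ⟨S'', h3, h4⟩ := ih₂ h2
    refine ⟨S'', ?_, h4⟩
    rw [← Expr.cost_shift K]
    exact Runs.loop_true (by rwa [Expr.eval_shift hS]) h1 h3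
  | loop_false he =>
    refine ⟨S, ?_, hS⟩
    rw [← Expr.cost_shift K]
    exact Runs.loop_false (by rwa [Expr.eval_shift hS])

/-! #### Indicator expressions -/

/-- `1` if the two values are equal, and `0` otherwise. -/
def eqE (a b : Expr) : Expr := .sub (.const 1) (.add (.sub a b) (.sub b a))

/-- `1` if the first value is smaller than the second one, and `0` otherwise. -/
def ltE (a b : Expr) : Expr := .sub (.const 1) (.sub (.const 1) (.sub b a))

/-- The conjunction of two truth values. -/
def andE (a b : Expr) : Expr := .sub (.add a b) (.const 1)

theorem eval_eqE (a b : Expr) (s : Store) :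
    (eqE a b).eval s = if a.eval s = b.eval s then 1 else 0 := by
  simp only [eqE, Expr.eval]
  split_ifs <;> omega

theorem eval_ltE (a b : Expr) (s : Store) :
    (ltE a b).eval s = if a.eval s < b.eval s then 1 else 0 := by
  simp only [ltE, Expr.eval]
  split_ifs <;> omega

theorem eval_andE (a b : Expr) (s : Store) :
    (andE a b).eval s = a.eval s + b.eval s - 1 := rfl

theorem indicator_and (p q : Prop) [Decidable p] [Decidable q] :
    (if p then 1 else 0) + (if q then 1 else 0) - 1 = if p ∧ q then 1 else 0 := by
  by_cases hp : p <;> by_cases hq : q <;> simp [hp, hq]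

/-- `0` if the two values are equal, and `1` otherwise. -/
def neE (a b : Expr) : Expr := .sub (.const 1) (eqE a b)

theorem eval_neE (a b : Expr) (s : Store) :
    (neE a b).eval s = if a.eval s ≠ b.eval s then 1 else 0 := by
  simp only [neE, Expr.eval, eval_eqE]
  by_cases h : a.eval s = b.eval s <;> simp [h]

end RAM

/-! ### Writing down the register program of a formula

The arrays `3, …, 7` hold the five components of the instructions, and the scalar `8` holds their
number. The scalar `9` holds the group size, `10` the number `M` of assignments of a group, and
`12` the number of groups. -/

namespace RAM

theorem WP.asg_seq {a : ℕ} {e : Expr} {P : Prog} {s : Store} {T : ℕ} {Q : Store → Prop}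
    (h : WP P (s.set a 0 (e.eval s)) T Q) : WP ((RAM.asg a e).seq P) s (e.cost + 2 + T) Q :=
  (WP.asg (Q := fun s' => s' = s.set a 0 (e.eval s)) rfl).seq fun _ hs' => hs' ▸ h

theorem WP.write_seq {a : ℕ} {i e : Expr} {P : Prog} {s : Store} {T : ℕ} {Q : Store → Prop}
    (h : WP P (s.set a (i.eval s) (e.eval s)) T Q) :
    WP ((Prog.write a i e).seq P) s (i.cost + e.cost + 1 + T) Q :=
  (WP.write (Q := fun s' => s' = s.set a (i.eval s) (e.eval s)) rfl).seq fun _ hs' => hs' ▸ h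

/-- The shape of frame conditions after a loop body and the update of the counter `i`. -/
theorem set_frame {s s' : Store} {W A : List ℕ} {i v w : ℕ} (hf : ∀ a, a ∉ W → s' a = s a)
    (hA : ∀ a ∈ A, a ≠ i ∧ a ∉ W) : ∀ a ∈ A, (s'.set i v w) a = s a := by
  intro a ha
  rw [Store.set_of_ne _ _ _ (hA a ha).1, hf a (hA a ha).2]

/-- The memory holds the list `L` of instructions. -/
def HoldsSlots (L : List Slot) (s : Store) : Prop :=
  s 8 0 = L.length ∧ ∀ i, s 3 i = (L.getD i default).tgt ∧ s 4 i = (L.getD i default).src₁ ∧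
    s 5 i = (L.getD i default).src₂ ∧ s 6 i = (L.getD i default).lhs ∧
    s 7 i = (L.getD i default).rhs

theorem HoldsSlots.congr {L : List Slot} {s s' : Store} (h : HoldsSlots L s)
    (hs : ∀ a ∈ [3, 4, 5, 6, 7, 8], s' a = s a) : HoldsSlots L s' := by
  simp only [List.mem_cons, List.not_mem_nil, or_false, forall_eq_or_imp, forall_eq] at hs
  obtain ⟨h3, h4, h5, h6, h7, h8⟩ := hs
  simpa only [HoldsSlots, h3, h4, h5, h6, h7, h8] using h

theorem HoldsSlots.set {L : List Slot} {s : Store} (h : HoldsSlots L s) {a i v : ℕ}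
    (ha : a ∉ [3, 4, 5, 6, 7, 8]) : HoldsSlots L (s.set a i v) :=
  h.congr fun _ hb => Store.set_of_ne _ _ _ fun e => ha (e ▸ hb)

/-- Append an instruction. -/
def emit (e₁ e₂ e₃ e₄ e₅ : Expr) : Prog :=
  (Prog.write 3 (sc 8) e₁).seq ((Prog.write 4 (sc 8) e₂).seq ((Prog.write 5 (sc 8) e₃).seq
    ((Prog.write 6 (sc 8) e₄).seq ((Prog.write 7 (sc 8) e₅).seq
      (asg 8 (.add (sc 8) (.const 1)))))))

/-- The expressions may not read the arrays being filled, so all five have their values on the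
initial memory although they are evaluated between the writes. -/
theorem WP.emit {L : List Slot} {s : Store} {e₁ e₂ e₃ e₄ e₅ : Expr} (h : HoldsSlots L s)
    (hr : ∀ a ∈ e₁.reads ++ e₂.reads ++ e₃.reads ++ e₄.reads ++ e₅.reads,
      a ∉ [3, 4, 5, 6, 7, 8]) :
    WP (emit e₁ e₂ e₃ e₄ e₅) s (e₁.cost + e₂.cost + e₃.cost + e₄.cost + e₅.cost + 21)
      (HoldsSlots (L ++ [⟨e₁.eval s, e₂.eval s, e₃.eval s, e₄.eval s, e₅.eval s⟩])) := by
  have ev : ∀ e : Expr, (∀ a ∈ e.reads, a ∉ [3, 4, 5, 6, 7, 8]) → ∀ s' a i x,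
      a ∈ [3, 4, 5, 6, 7, 8] → e.eval (Store.set s' a i x) = e.eval s' := by
    intro e he s' a i x ha
    refine Expr.eval_congr fun b hb => Store.set_of_ne _ _ _ ?_
    rintro rfl
    exact he _ hb ha
  have h2 := ev e₂ fun a ha => hr a (by simp [ha])
  have h3 := ev e₃ fun a ha => hr a (by simp [ha])
  have h4 := ev e₄ fun a ha => hr a (by simp [ha])
  have h5 := ev e₅ fun a ha => hr a (by simp [ha])
  refine (WP.write_seq <| WP.write_seq <| WP.write_seq <| WP.write_seq <| WP.write_seq <|
    WP.asg ?_).mono (by simp only [cost_sc, Expr.cost]; omega) fun _ h => h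
  obtain ⟨hn, hi⟩ := h
  rw [h5 _ 6 _ _ (by simp), h5 _ 5 _ _ (by simp), h5 _ 4 _ _ (by simp), h5 _ 3 _ _ (by simp),
    h4 _ 5 _ _ (by simp), h4 _ 4 _ _ (by simp), h4 _ 3 _ _ (by simp),
    h3 _ 4 _ _ (by simp), h3 _ 3 _ _ (by simp), h2 _ 3 _ _ (by simp)]
  have hget : ∀ (c : Slot) i, (L ++ [c]).getD i default =
      if i = L.length then c else L.getD i default := by
    intro c i
    rcases lt_trichotomy i L.length with h | h | h
    · rw [List.getD_append _ _ _ _ h, if_neg h.ne]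
    · subst h
      simp
    · rw [List.getD_eq_default _ _ h.le, List.getD_eq_default _ _ (by simpa using h),
        if_neg h.ne']
  refine ⟨?_, fun i => ?_⟩
  · simp [Store.set_apply, Expr.eval, hn]
  · rw [hget]
    by_cases hiL : i = L.length
    · simp [Store.set_apply, hn, hiL]
    · simpa [Store.set_apply, hn, hiL] using hi i

/-- The memory holds the formula with the literals `(x e, g e)` and the parameters of its
register program. -/
structure Ctx (n m l M : ℕ) (x g : ℕ → ℕ) (s : Store) : Prop where
  n_eq : s 0 0 = n
  m_eq : s 0 1 = m
  x_eq : s 1 = x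
  g_eq : s 2 = g
  l_eq : s 9 0 = l
  M_eq : s 10 0 = M

theorem Ctx.congr {n m l M : ℕ} {x g : ℕ → ℕ} {s s' : Store} (h : Ctx n m l M x g s)
    (hs : ∀ a ∈ [0, 1, 2, 9, 10], s' a = s a) : Ctx n m l M x g s' := by
  simp only [List.mem_cons, List.not_mem_nil, or_false, forall_eq_or_imp, forall_eq] at hs
  obtain ⟨h0, h1, h2, h3, h4⟩ := hs
  exact ⟨by rw [h0, h.1], by rw [h0, h.2], by rw [h1, h.3], by rw [h2, h.4], by rw [h3, h.5],
    by rw [h4, h.6]⟩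

theorem Ctx.set {n m l M : ℕ} {x g : ℕ → ℕ} {s : Store} (h : Ctx n m l M x g s) {a i v : ℕ}
    (ha : a ∉ [0, 1, 2, 9, 10]) : Ctx n m l M x g (s.set a i v) :=
  h.congr fun _ hb => Store.set_of_ne _ _ _ fun e => ha (e ▸ hb)

/-! #### The parameters -/

/-- Compute the group size and the number of assignments of a group. -/
def paramProg : Prog :=
  (asg 9 (.const 1)).seq ((asg 10 (.const 2)).seq ((asg 11 (.const 4)).seq
    (.loop (.sub (.add (sc 0) (.const 1)) (sc 11))
      ((asg 9 (.add (sc 9) (.const 1))).seq ((asg 10 (.add (sc 10) (sc 10))).seq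
        ((asg 11 (.add (sc 11) (sc 11))).seq (asg 11 (.add (sc 11) (sc 11)))))))))

/-- The scalar `11` runs through the powers of 4, and the loop goes on while `4 ^ (k + 1) ≤ n`, that
is, for `Nat.log 4 n` rounds. -/
theorem WP.paramProg {n : ℕ} {s : Store} (hs : s 0 0 = n) :
    WP paramProg s (n * 50 + 50) fun s' =>
      s' 9 0 = ThreeCNF.groupSize n ∧ s' 10 0 = 2 ^ ThreeCNF.groupSize n := by
  refine (WP.asg_seq <| WP.asg_seq <| WP.asg_seq <|
    WP.loop (N := Nat.log 4 n) (T := 4 * 7) (fun k s => s 0 0 = n ∧ s 9 0 = k + 1 ∧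
      s 10 0 = 2 ^ (k + 1) ∧ s 11 0 = 4 ^ (k + 1)) ?_ ?_ ?_ ?_).mono ?_ fun s' h => ⟨h.2.1, h.2.2.1⟩
  · simp [Store.set_apply, Expr.eval, hs]
  · rintro s ⟨h1, h2, h3, h4⟩
    simp only [Expr.eval, eval_sc, h1, h4]
    have := Nat.lt_pow_succ_log_self (b := 4) (by norm_num) n
    simp only [Nat.succ_eq_add_one] at this
    omega
  · rintro k hk s ⟨h1, h2, h3, h4⟩
    simp only [Expr.eval, eval_sc, h1, h4]
    have hn : n ≠ 0 := by
      rintro rfl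
      simp at hk
    have := (Nat.pow_le_pow_right (by norm_num : 4 > 0) hk).trans (Nat.pow_log_le_self 4 hn)
    simp only [Nat.succ_eq_add_one] at this
    omega
  · rintro k hk s ⟨h1, h2, h3, h4⟩
    refine (WP.asg_seq <| WP.asg_seq <| WP.asg_seq <| WP.asg ?_).mono
      (by simp [Expr.cost]) fun _ h => h
    simp only [Store.set_apply, Expr.eval, sc, h1, h2, h3, h4]
    norm_num
    constructor <;> ring
  · simp only [Expr.cost, cost_sc]
    have : Nat.log 4 n ≤ n := Nat.log_le_self 4 n
    omega

/-! #### The blocks -/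

/-- Write down `groupBlock M i`, where `i` is the scalar `14`. -/
def groupProg : Prog :=
  (emit (.add (.add (sc 10) (.const 3)) (sc 14)) (.const 0) (.const 0) (sc 10) (.const 0)).seq
    (forLoop 16 (sc 10) (emit (.add (.add (sc 10) (.const 3)) (sc 14))
      (.add (.add (sc 10) (.const 3)) (sc 14)) (sc 16) (sc 10) (.const 0)))

section Blocks

variable {n m l M : ℕ} {x g : ℕ → ℕ} {s : Store} {L : List Slot}

theorem WP.groupProg {i : ℕ} (hc : Ctx n m l M x g s) (hi : s 14 0 = i) (hL : HoldsSlots L s) :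
    WP groupProg s (M * 60 + 60) (HoldsSlots (L ++ Slot.groupBlock M i)) := by
  refine (WP.seq (WP.frame (WP.emit hL (by decide +kernel))) (T' := M * 52 + 12) ?_).mono
    (by simp only [Expr.cost, cost_sc]; omega) fun _ h => h
  rintro s₁ ⟨h1, f1⟩
  simp only [Expr.eval, eval_sc, hc.M_eq, hi] at h1
  have hc1 : Ctx n m l M x g s₁ := hc.congr fun a ha => f1 a (by revert a; decide +kernel)
  have hi1 : s₁ 14 0 = i := by rw [f1 14 (by decide +kernel), hi]
  refine (WP.forLoop (N := M) (T := 40) (fun k s => Ctx n m l M x g s ∧ s 14 0 = i ∧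
    HoldsSlots (L ++ Slot.choose M (M + 3 + i) 0 0 ::
      (List.range k).map fun j => Slot.choose M (M + 3 + i) (M + 3 + i) j) s)
    (by decide +kernel) ?_ ?_ ?_).mono (by simp only [cost_sc]; omega) fun s' h => h.2.2
  · exact ⟨hc1.set (by decide +kernel), by simp [Store.set_apply, hi1], h1.set (by decide +kernel)⟩
  · rintro k s ⟨hc, -, -⟩
    exact hc.M_eq
  · rintro k hk s ⟨hc, hi, hL⟩ hk'
    refine ((WP.emit hL (by decide +kernel))).mono (by simp only [Expr.cost, cost_sc]; omega) ?_
    intro s' hL' f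
    refine ⟨hc.congr (set_frame f (by decide +kernel)), ?_, ?_⟩
    · rw [Store.set_of_ne _ _ _ (by decide +kernel), f 14 (by decide +kernel), hi]
    · simp only [Expr.eval, eval_sc, hc.M_eq, hi, hk', List.append_assoc, List.cons_append] at hL'
      rw [List.range_succ, List.map_append]
      exact hL'.set (by decide +kernel)

/-- Let the scalar `20` be `2 ^ b`, where `b` is the scalar `19`. -/
def powProg : Prog :=
  (asg 20 (.const 1)).seq (forLoop 21 (sc 19) (asg 20 (.add (sc 20) (sc 20))))

theorem WP.powProg {b : ℕ} (hb : s 19 0 = b) :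
    WP powProg s (b * 19 + 20) fun s' => s' 20 0 = 2 ^ b := by
  refine (WP.asg_seq <| WP.forLoop (N := b) (T := 7) (fun k s => s 19 0 = b ∧ s 20 0 = 2 ^ k)
    (by decide +kernel) ?_ ?_ ?_).mono (by simp only [cost_sc, Expr.cost]; omega) fun _ h => h.2
  · simp [Store.set_apply, hb, Expr.eval]
  · rintro k s ⟨h1, -⟩
    exact h1
  · rintro k hk s ⟨h1, h2⟩ -
    refine (WP.asg ?_).mono (by simp [Expr.cost]) fun _ h => h
    intro _
    simp only [Store.set_apply, Expr.eval, eval_sc, h1, h2]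
    norm_num
    ring

/-- Append the assertion that belongs to the assignment `j` of a group, where `j` is the scalar
`16`, the number of the literal is the scalar `17`, and the scalar `20` is `2 ^ b` for the number
`b` of its variable in the group. -/
def mismatchProg : Prog :=
  (divMod 22 23 (sc 16) (sc 20)).seq ((divMod 24 25 (sc 22) (.const 2)).seq
    (emit (sc 10) (sc 10) (sc 10) (.add (sc 10)
      (.add (.sub (sc 25) (.read 2 (sc 17))) (.sub (.read 2 (sc 17)) (sc 25)))) (sc 16)))

/-- Dividing `j` by `2 ^ b` and the quotient by 2 leaves the bit `b` of `j` as the remainder. -/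
theorem WP.mismatchProg {b e j : ℕ} (hc : Ctx n m l M x g s) (he : s 17 0 = e)
    (hp : s 20 0 = 2 ^ b) (hj : s 16 0 = j) (hjM : j ≤ M) (hL : HoldsSlots L s) :
    WP mismatchProg s (M * 46 + 138)
      (HoldsSlots (L ++ [Slot.assertNe M (M + Slot.mismatch b (g e) j) j])) := by
  refine (WP.seq (WP.frame (WP.divMod j (2 ^ b) (by decide) (by decide) (by decide)
    (by exact hj) (by exact hp) (by positivity))) (T' := M * 22 + 114) ?_).mono
    (by simp only [cost_sc]; omega) fun _ h => h
  rintro s₄ ⟨⟨hq4, -⟩, f4⟩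
  have hc4 : Ctx n m l M x g s₄ := hc.congr fun a ha => f4 a (by revert a; decide +kernel)
  have he4 : s₄ 17 0 = e := by rw [f4 17 (by decide +kernel), he]
  have hj4 : s₄ 16 0 = j := by rw [f4 16 (by decide +kernel), hj]
  have hL4 : HoldsSlots L s₄ := hL.congr fun a ha => f4 a (by revert a; decide +kernel)
  have hjM : j / 2 ^ b ≤ M := (Nat.div_le_self _ _).trans hjM
  refine (WP.seq (WP.frame (WP.divMod (j / 2 ^ b) 2 (by decide) (by decide) (by decide)
    (by exact hq4) rfl (by norm_num))) (T' := 91) ?_).mono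
    (by simp only [cost_sc, Expr.cost]; omega) fun _ h => h
  rintro s₅ ⟨⟨-, hr5⟩, f5⟩
  have hc5 : Ctx n m l M x g s₅ := hc4.congr fun a ha => f5 a (by revert a; decide +kernel)
  have he5 : s₅ 17 0 = e := by rw [f5 17 (by decide +kernel), he4]
  have hj5 : s₅ 16 0 = j := by rw [f5 16 (by decide +kernel), hj4]
  have hL5 : HoldsSlots L s₅ := hL4.congr fun a ha => f5 a (by revert a; decide +kernel)
  refine (WP.emit hL5 (by decide +kernel)).mono (by simp only [cost_sc, Expr.cost]; omega) ?_
  intro s₆ hL6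
  simp only [Expr.eval, eval_sc, hc5.M_eq, hc5.g_eq, hr5, he5, hj5] at hL6
  exact hL6

/-- Write down `literalBlock l M (x e) (g e)`, where `e` is the scalar `17`, and increase `e`. -/
def literalProg : Prog :=
  (divMod 18 19 (.read 1 (sc 17)) (sc 9)).seq (powProg.seq
    ((emit (.add (sc 10) (.const 1)) (sc 10) (.add (.add (sc 10) (.const 3)) (sc 18)) (sc 10)
      (.const 0)).seq
      ((forLoop 16 (sc 10) mismatchProg).seq
        ((emit (.add (sc 10) (.const 2)) (.add (sc 10) (.const 2)) (.add (sc 10) (.const 1))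
          (sc 10) (.const 0)).seq
          (asg 17 (.add (sc 17) (.const 1)))))))

/-- In the time bound, `n` accounts for the division of the variable by `l`, `l` for the power of 2,
and the product for `M` assertions of cost `O(M)` each. -/
theorem WP.literalProg {e : ℕ} (hl : 0 < l) (hx : x e ≤ n) (hc : Ctx n m l M x g s)
    (he : s 17 0 = e) (hL : HoldsSlots L s) :
    WP literalProg s (n * 24 + l * 19 + M * (M * 46 + 150) + 200) fun s' =>
      HoldsSlots (L ++ Slot.literalBlock l M (x e) (g e)) s' ∧ s' 17 0 = e + 1 := by
  have hxn : x e * 24 ≤ n * 24 := Nat.mul_le_mul_right _ hx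
  have hM2 : M * (M * 46 + 138 + 2 + 10) = M * (M * 46 + 150) := by ring
  refine (WP.seq (WP.frame (WP.divMod (x e) l (by decide) (by decide) (by decide)
    (by simp [Expr.eval, he, hc.x_eq]) (by exact hc.l_eq) hl))
    (T' := l * 19 + M * (M * 46 + 150) + 170) ?_).mono
    (by simp only [Expr.cost, cost_sc]; omega) fun _ h => h
  rintro s₁ ⟨⟨hq1, hb1⟩, f1⟩
  have hc1 : Ctx n m l M x g s₁ := hc.congr fun a ha => f1 a (by revert a; decide +kernel)
  have he1 : s₁ 17 0 = e := by rw [f1 17 (by decide +kernel), he]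
  have hL1 : HoldsSlots L s₁ := hL.congr fun a ha => f1 a (by revert a; decide +kernel)
  have hbl : x e % l ≤ l := (Nat.mod_lt _ hl).le
  refine (WP.seq (WP.frame (WP.powProg hb1)) (T' := M * (M * 46 + 150) + 150) ?_).mono
    (by omega) fun _ h => h
  rintro s₂ ⟨hp2, f2⟩
  have hc2 : Ctx n m l M x g s₂ := hc1.congr fun a ha => f2 a (by revert a; decide +kernel)
  have he2 : s₂ 17 0 = e := by rw [f2 17 (by decide +kernel), he1]
  have hq2 : s₂ 18 0 = x e / l := by rw [f2 18 (by decide +kernel), hq1]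
  have hL2 : HoldsSlots L s₂ := hL1.congr fun a ha => f2 a (by revert a; decide +kernel)
  refine (WP.seq (WP.frame (WP.emit hL2 (by decide +kernel))) (T' := M * (M * 46 + 150) + 60) ?_).mono
    (by simp only [Expr.cost, cost_sc]; omega) fun _ h => h
  rintro s₃ ⟨hL3, f3⟩
  have hc3 : Ctx n m l M x g s₃ := hc2.congr fun a ha => f3 a (by revert a; decide +kernel)
  have he3 : s₃ 17 0 = e := by rw [f3 17 (by decide +kernel), he2]
  have hp3 : s₃ 20 0 = 2 ^ (x e % l) := by rw [f3 20 (by decide +kernel), hp2]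
  simp only [Expr.eval, eval_sc, hc2.M_eq, hq2] at hL3
  refine (WP.seq (T := M * (M * 46 + 138 + 2 + 10) + 2 + 10) (T' := 48)
    ((WP.forLoop (N := M) (T := M * 46 + 138)
    (fun k s => Ctx n m l M x g s ∧ s 17 0 = e ∧ s 20 0 = 2 ^ (x e % l) ∧
      HoldsSlots (L ++ Slot.choose M (M + 1) M (M + 3 + x e / l) ::
        (List.range k).map fun j => Slot.assertNe M (M + Slot.mismatch (x e % l) (g e) j) j) s)
    (by decide +kernel) ?_ ?_ ?_).mono (by simp only [cost_sc]; omega) fun _ h => h) ?_).mono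
    (by omega) fun _ h => h
  · exact ⟨hc3.set (by decide +kernel), by simp [Store.set_apply, he3], by simp [Store.set_apply, hp3],
      hL3.set (by decide +kernel)⟩
  · rintro k s ⟨hc, -⟩
    exact hc.M_eq
  · rintro j hj s ⟨hc, he, hp, hL⟩ hj'
    refine (WP.mismatchProg hc he hp hj' hj.le hL).mono le_rfl ?_
    intro s' hL' f
    simp only [List.append_assoc, List.cons_append] at hL'
    refine ⟨hc.congr (set_frame f (by decide +kernel)), ?_, ?_, ?_⟩
    · rw [Store.set_of_ne _ _ _ (by decide +kernel), f 17 (by decide +kernel), he]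
    · rw [Store.set_of_ne _ _ _ (by decide +kernel), f 20 (by decide +kernel), hp]
    · rw [List.range_succ, List.map_append]
      exact hL'.set (by decide +kernel)
  · rintro s₄ ⟨hc4, he4, -, hL4⟩
    refine (WP.seq (WP.frame (WP.emit hL4 (by decide +kernel))) (T' := 6) ?_).mono
      (by simp only [cost_sc, Expr.cost]; omega) fun _ h => h
    rintro s₅ ⟨hL5, f5⟩
    refine (WP.asg ?_).mono (by simp [Expr.cost]) fun _ h => h
    simp only [Expr.eval, eval_sc, hc4.M_eq, List.append_assoc, List.cons_append] at hL5
    refine ⟨hL5.set (by decide +kernel), ?_⟩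
    simp [Store.set_apply, Expr.eval, f5 17 (by decide +kernel), he4]

/-- Write down `clauseBlock l M x g c`, where `3 c` is the scalar `17`, and increase the latter. -/
def clauseProg : Prog :=
  (emit (.add (sc 10) (.const 2)) (sc 10) (sc 10) (sc 10) (.const 0)).seq
    ((forLoop 15 (.const 3) literalProg).seq
      (emit (sc 10) (sc 10) (sc 10) (.add (sc 10) (.const 2)) (sc 10)))

theorem WP.clauseProg {c : ℕ} (hl : 0 < l) (hx : ∀ k < 3, x (3 * c + k) ≤ n)
    (hc : Ctx n m l M x g s) (he : s 17 0 = 3 * c) (hL : HoldsSlots L s) :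
    WP clauseProg s (3 * (n * 24 + l * 19 + M * (M * 46 + 150) + 250)) fun s' =>
      HoldsSlots (L ++ Slot.clauseBlock l M x g c) s' ∧ s' 17 0 = 3 * (c + 1) := by
  refine (WP.seq (WP.frame (WP.emit hL (by decide +kernel)))
    (T' := 3 * (n * 24 + l * 19 + M * (M * 46 + 150) + 200 + 1 + 10) + 60) ?_).mono
    (by simp only [Expr.cost, cost_sc]; omega) fun _ h => h
  rintro s₁ ⟨h1, f1⟩
  simp only [Expr.eval, eval_sc, hc.M_eq] at h1
  have hc1 : Ctx n m l M x g s₁ := hc.congr fun a ha => f1 a (by revert a; decide +kernel)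
  have he1 : s₁ 17 0 = 3 * c := by rw [f1 17 (by decide +kernel), he]
  refine (WP.seq (T' := 40) (WP.forLoop (N := 3)
    (T := n * 24 + l * 19 + M * (M * 46 + 150) + 200)
    (fun k s => Ctx n m l M x g s ∧ s 17 0 = 3 * c + k ∧
      HoldsSlots (L ++ Slot.choose M (M + 2) M M :: (List.range k).flatMap fun k =>
        Slot.literalBlock l M (x (3 * c + k)) (g (3 * c + k))) s)
    (by decide +kernel) ?_ ?_ ?_) ?_).mono (by simp only [Expr.cost]; omega) fun s' h => h
  · exact ⟨hc1.set (by decide +kernel), by simp [Store.set_apply, he1], h1.set (by decide +kernel)⟩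
  · rintro k s -
    rfl
  · rintro k hk s ⟨hc, he, hL⟩ hk'
    refine (WP.literalProg hl (hx k hk) hc he hL).mono le_rfl ?_
    rintro s' ⟨hL', he'⟩ f
    refine ⟨hc.congr (set_frame f (by decide +kernel)), ?_, ?_⟩
    · rw [Store.set_of_ne _ _ _ (by decide +kernel), he']
      ring
    · simp only [List.append_assoc, List.cons_append] at hL'
      rw [List.range_succ, List.flatMap_append]
      simp only [List.flatMap_cons, List.flatMap_nil, List.append_nil]
      exact hL'.set (by decide +kernel)
  · rintro s₂ ⟨hc2, he2, hL2⟩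
    refine (WP.frame (WP.emit hL2 (by decide +kernel))).mono (by simp [Expr.cost]) ?_
    rintro s₃ ⟨hL3, f3⟩
    simp only [Expr.eval, eval_sc, hc2.M_eq, List.append_assoc, List.cons_append] at hL3
    refine ⟨hL3, ?_⟩
    rw [f3 17 (by decide +kernel), he2]
    ring

/-- Write down the whole register program. -/
def slotsProg : Prog :=
  paramProg.seq ((divMod 12 13 (sc 0) (sc 9)).seq
    ((asg 12 (.add (sc 12) (.const 1))).seq
      ((emit (sc 10) (sc 10) (sc 10) (sc 10) (.const 0)).seq
        ((forLoop 14 (sc 12) groupProg).seq ((asg 17 (.const 0)).seq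
          (forLoop 14 (.read 0 (.const 1)) clauseProg))))))

/-- A bound for the running time of `slotsProg`. -/
def slotsTime (n m l M : ℕ) : ℕ :=
  n * 100 + (n + 1) * (M * 60 + 80) +
    m * (3 * (n * 24 + l * 19 + M * (M * 46 + 150) + 260)) + 200

end Blocks

open ThreeCNF in
theorem WP.slotsProg {n : ℕ} (φ : ThreeCNF n) :
    WP slotsProg (load φ.encode) (slotsTime n φ.length (groupSize n) (2 ^ groupSize n)) fun s =>
      HoldsSlots φ.slots s ∧ s 12 0 + s 10 0 + 3 = numRegs n := by
  have hl : 0 < groupSize n := Nat.succ_pos _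
  set l := groupSize n with hldef
  set M := 2 ^ l with hM
  have i0 : load φ.encode 0 0 = n := rfl
  have i1 : load φ.encode 0 1 = φ.length := rfl
  have i2 : load φ.encode 1 = φ.litVar := rfl
  have i3 : load φ.encode 2 = φ.litSign := rfl
  have i4 : ∀ a ∈ [3, 4, 5, 6, 7, 8], load φ.encode a = fun _ => 0 := by
    intro a ha
    fin_cases ha <;> rfl
  -- The default instruction consists of zeros, and so do the arrays not used by the input.
  have hL0 : HoldsSlots [] (load φ.encode) := by
    simp only [List.mem_cons, List.not_mem_nil, or_false, forall_eq_or_imp, forall_eq] at i4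
    obtain ⟨h3, h4, h5, h6, h7, h8⟩ := i4
    refine ⟨by rw [h8]; rfl, fun i => ?_⟩
    rw [h3, h4, h5, h6, h7]
    exact ⟨rfl, rfl, rfl, rfl, rfl⟩
  refine (WP.seq (WP.frame (WP.paramProg i0)) (T' := n * 24 + 36 + ((n + 1) * (M * 60 + 80) +
    φ.length * (3 * (n * 24 + l * 19 + M * (M * 46 + 150) + 260)) + 100)) ?_).mono
    (by unfold slotsTime; omega) fun _ h => h
  rintro s₁ ⟨⟨hl1, hM1⟩, f1⟩
  have hc1 : Ctx n φ.length l M φ.litVar φ.litSign s₁ :=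
    ⟨by rw [f1 0 (by decide +kernel), i0], by rw [f1 0 (by decide +kernel), i1], by rw [f1 1 (by decide +kernel), i2],
      by rw [f1 2 (by decide +kernel), i3], hl1, hM1⟩
  have hL1 : HoldsSlots [] s₁ := hL0.congr fun a ha => f1 a (by revert a; decide +kernel)
  refine (WP.seq (WP.frame (WP.divMod n l (by decide) (by decide) (by decide)
    (by exact hc1.n_eq) (by exact hc1.l_eq) hl)) (T' := 6 + ((n + 1) * (M * 60 + 80) +
    φ.length * (3 * (n * 24 + l * 19 + M * (M * 46 + 150) + 260)) + 100)) ?_).mono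
    (by simp only [cost_sc]; omega) fun _ h => h
  rintro s₂ ⟨⟨hg2, -⟩, f2⟩
  refine (WP.asg_seq (T := (n + 1) * (M * 60 + 80) +
    φ.length * (3 * (n * 24 + l * 19 + M * (M * 46 + 150) + 260)) + 100) ?_).mono
    (by simp only [Expr.cost, cost_sc]; omega) fun _ h => h
  have f2' : ∀ a ∈ [0, 1, 2, 3, 4, 5, 6, 7, 8, 9, 10],
      (s₂.set 12 0 ((Expr.add (sc 12) (.const 1)).eval s₂)) a = s₁ a := set_frame f2 (by decide +kernel)
  have hg3 : (s₂.set 12 0 ((Expr.add (sc 12) (.const 1)).eval s₂)) 12 0 = n / l + 1 := by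
    simp [Store.set_apply, Expr.eval, hg2]
  generalize s₂.set 12 0 ((Expr.add (sc 12) (.const 1)).eval s₂) = s₃ at f2' hg3
  have hc3 : Ctx n φ.length l M φ.litVar φ.litSign s₃ :=
    hc1.congr fun a ha => f2' a (by revert a; decide +kernel)
  have hL3 : HoldsSlots [] s₃ := hL1.congr fun a ha => f2' a (by revert a; decide +kernel)
  have hG : n / l + 1 ≤ n + 1 := Nat.succ_le_succ (Nat.div_le_self _ _)
  generalize hGd : n / l + 1 = G at hg3 hG
  have hGM : G * (M * 60 + 60 + 2 + 10) ≤ (n + 1) * (M * 60 + 80) := Nat.mul_le_mul hG (by omega)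
  refine (WP.seq (WP.frame (WP.emit hL3 (by decide +kernel))) (T' := G * (M * 60 + 60 + 2 + 10) +
    φ.length * (3 * (n * 24 + l * 19 + M * (M * 46 + 150) + 260)) + 60) ?_).mono
    (by simp only [Expr.cost, cost_sc]; omega) fun _ h => h
  rintro s₄ ⟨hL4, f4⟩
  simp only [Expr.eval, eval_sc, hc3.M_eq, List.nil_append] at hL4
  have hc4 : Ctx n φ.length l M φ.litVar φ.litSign s₄ :=
    hc3.congr fun a ha => f4 a (by revert a; decide +kernel)
  have hg4 : s₄ 12 0 = G := by rw [f4 12 (by decide +kernel), hg3]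
  refine (WP.seq (T := G * (M * 60 + 60 + 2 + 10) + 12)
    (T' := φ.length * (3 * (n * 24 + l * 19 + M * (M * 46 + 150) + 260)) + 40)
    ((WP.forLoop (N := G) (T := M * 60 + 60) (fun k s =>
    Ctx n φ.length l M φ.litVar φ.litSign s ∧ s 12 0 = G ∧
      HoldsSlots (Slot.assertNe M M 0 :: (List.range k).flatMap (Slot.groupBlock M)) s)
    (by decide +kernel) ?_ ?_ ?_).mono (by simp only [cost_sc]; omega) fun _ h => h) ?_).mono
    (by omega) fun _ h => h
  · exact ⟨hc4.set (by decide +kernel), by simp [Store.set_apply, hg4], hL4.set (by decide +kernel)⟩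
  · rintro k s ⟨-, h, -⟩
    exact h
  · rintro k hk s ⟨hc, hg, hL⟩ hk'
    refine (WP.groupProg hc hk' hL).mono le_rfl fun s' hL' f => ?_
    refine ⟨hc.congr (set_frame f (by decide +kernel)), ?_, ?_⟩
    · rw [Store.set_of_ne _ _ _ (by decide +kernel), f 12 (by decide +kernel), hg]
    · rw [List.range_succ, List.flatMap_append]
      simp only [List.flatMap_cons, List.flatMap_nil, List.append_nil]
      exact hL'.set (by decide +kernel)
  · rintro s₅ ⟨hc5, hg5, hL5⟩
    refine (WP.asg_seq (WP.forLoop (N := φ.length)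
      (T := 3 * (n * 24 + l * 19 + M * (M * 46 + 150) + 250)) (fun k s =>
      Ctx n φ.length l M φ.litVar φ.litSign s ∧ s 12 0 = G ∧ s 17 0 = 3 * k ∧
        HoldsSlots (Slot.assertNe M M 0 :: ((List.range G).flatMap (Slot.groupBlock M) ++
          (List.range k).flatMap (Slot.clauseBlock l M φ.litVar φ.litSign))) s)
      (by decide +kernel) ?_ ?_ ?_)).mono ?_ ?_
    · exact ⟨(hc5.set (by decide +kernel)).set (by decide +kernel), by simp [Store.set_apply, hg5],
        by simp [Store.set_apply, Expr.eval],
        by simpa only [List.range_zero, List.flatMap_nil, List.append_nil] using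
          HoldsSlots.set (HoldsSlots.set hL5 (a := 17) (by decide +kernel)) (by decide +kernel)⟩
    · rintro k s ⟨h, -⟩
      exact h.m_eq
    · rintro c hcm s ⟨hc, hg, he, hL⟩ -
      refine (WP.clauseProg hl (fun k hk => (φ.litVar_lt (by omega)).le) hc he hL).mono
        le_rfl ?_
      rintro s' ⟨hL', he'⟩ f
      refine ⟨hc.congr (set_frame f (by decide +kernel)), ?_, ?_, ?_⟩
      · rw [Store.set_of_ne _ _ _ (by decide +kernel), f 12 (by decide +kernel), hg]
      · rw [Store.set_of_ne _ _ _ (by decide +kernel), he']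
      · rw [List.range_succ, List.flatMap_append]
        simp only [List.flatMap_cons, List.flatMap_nil, List.append_nil]
        simp only [List.append_assoc, List.cons_append] at hL'
        exact hL'.set (by decide +kernel)
    · simp only [Expr.cost]
      have : φ.length * (3 * (n * 24 + l * 19 + M * (M * 46 + 150) + 250) +
          (1 + 1) + 10) ≤
          φ.length * (3 * (n * 24 + l * 19 + M * (M * 46 + 150) + 260)) :=
        Nat.mul_le_mul_left _ (by omega)
      omega
    · rintro s' ⟨hc, hg, -, hL⟩
      refine ⟨?_, ?_⟩
      · subst hGd
        exact hL
      · rw [hg, hc.M_eq, ← hGd, hM, hldef, numRegs]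
        ring

end RAM

/-! ### Writing down the game

The scalar `26` holds the number `R` of registers. The scalars `27, …, 30` hold the layers and the
positions of the two vertices of the current entry of the matrices, and `31` holds its number. The
encoding of the game is written to the arrays `32, …, 35`. -/

namespace RAM

/-- The sum of the positive terms of the current weight. -/
def plusE : Expr :=
  .add (.add (andE (eqE (sc 28) (sc 26)) (andE (eqE (sc 27) (sc 29))
      (eqE (sc 30) (.read 6 (sc 27)))))
    (andE (eqE (sc 28) (.add (sc 26) (.const 1))) (andE (eqE (sc 27) (sc 29))
      (eqE (sc 30) (sc 26)))))
  (.add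
    (.add
      (andE (andE (ltE (sc 28) (sc 26)) (eqE (sc 27) (.add (sc 29) (.const 1))))
        (andE (eqE (sc 28) (.read 3 (sc 27))) (eqE (sc 30) (.read 4 (sc 27)))))
      (andE (andE (ltE (sc 28) (sc 26)) (eqE (sc 27) (.add (sc 29) (.const 1))))
        (andE (eqE (sc 28) (.read 3 (sc 27))) (eqE (sc 30) (.read 5 (sc 27))))))
    (.add
      (andE (andE (ltE (sc 28) (sc 26)) (eqE (sc 27) (.add (sc 29) (.const 1))))
        (andE (neE (sc 28) (.read 3 (sc 27))) (eqE (sc 30) (sc 28))))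
      (andE (andE (ltE (sc 28) (sc 26)) (eqE (sc 27) (.add (sc 29) (.const 1))))
        (andE (neE (sc 28) (.read 3 (sc 27))) (eqE (sc 30) (sc 28))))))

/-- The sum of the negative terms of the current weight. -/
def minusE : Expr :=
  .add (andE (andE (eqE (sc 28) (sc 26)) (eqE (sc 27) (sc 29))) (eqE (sc 30) (.read 7 (sc 27))))
    (andE (andE (eqE (sc 28) (sc 26)) (eqE (sc 27) (sc 29)))
      (eqE (sc 30) (.add (sc 26) (.const 1))))

section Entries

variable {R : ℕ} {L : List Slot} {s : Store} {t i t' i' : ℕ}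

/-- Expressions cannot branch, so each case is a conjunction of indicators, and the weight 2 of a
copy is the same indicator added twice. The hypothesis `hi` leaves `i < R` as the case besides `R`
and `R + 1`. -/
theorem eval_plusE (hL : HoldsSlots L s) (hR : s 26 0 = R) (h1 : s 27 0 = t) (h2 : s 28 0 = i)
    (h3 : s 29 0 = t') (h4 : s 30 0 = i') (hi : i < R + 2) :
    plusE.eval s = Slot.plus R L t i t' i' := by
  obtain ⟨-, hL⟩ := hL
  obtain ⟨l1, l2, l3, l4, l5⟩ := hL t
  simp only [plusE, Expr.eval, eval_andE, eval_eqE, eval_ltE, eval_neE, eval_sc, h1, h2, h3, h4,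
    hR, l1, l2, l3, l4, indicator_and, Slot.plus]
  by_cases c1 : i = R
  · simp [c1]
  by_cases c2 : i = R + 1
  · simp [c2]
  have c3 : i < R := by omega
  by_cases c4 : t = t' + 1
  · by_cases c5 : i = (L.getD t default).tgt
    · simp only [c1, c2, c3, c4, if_true, if_false, true_and, false_and]
      rw [← c4]
      simp [c5]
    · simp only [c1, c2, c3, c4, if_true, if_false, true_and, false_and]
      rw [← c4]
      generalize L.getD t default = c at c5 ⊢
      by_cases c6 : i' = i <;> simp [c5, c6]
  · simp [c1, c2, c4]

theorem eval_minusE (hL : HoldsSlots L s) (hR : s 26 0 = R) (h1 : s 27 0 = t) (h2 : s 28 0 = i)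
    (h3 : s 29 0 = t') (h4 : s 30 0 = i') : minusE.eval s = Slot.minus R L t i t' i' := by
  obtain ⟨-, hL⟩ := hL
  obtain ⟨l1, l2, l3, l4, l5⟩ := hL t
  simp only [minusE, Expr.eval, eval_andE, eval_eqE, eval_sc, h1, h2, h3, h4, hR, l5,
    indicator_and, Slot.minus]
  by_cases c : i = R ∧ t = t' <;> simp [c]

/-- The sum of the positive terms of the entry `p` of the weight matrix. -/
def plusAt (R : ℕ) (L : List Slot) (p : ℕ) : ℕ :=
  Slot.plus R L (p / (L.length * (R + 2)) / (R + 2)) (p / (L.length * (R + 2)) % (R + 2))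
    (p % (L.length * (R + 2)) / (R + 2)) (p % (L.length * (R + 2)) % (R + 2))

/-- The sum of the negative terms of the entry `p` of the weight matrix. -/
def minusAt (R : ℕ) (L : List Slot) (p : ℕ) : ℕ :=
  Slot.minus R L (p / (L.length * (R + 2)) / (R + 2)) (p / (L.length * (R + 2)) % (R + 2))
    (p % (L.length * (R + 2)) / (R + 2)) (p % (L.length * (R + 2)) % (R + 2))

/-- The number of an entry of the matrices. -/
def entry (R : ℕ) (L : List Slot) (t i t' i' : ℕ) : ℕ :=
  ((t * (R + 2) + i) * L.length + t') * (R + 2) + i'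

/-- The number of an entry has the mixed-radix digits `t, i, t', i'`. Nested loops over the digits
visit the entries in increasing order, so a counter replaces multiplication and division. -/
theorem entry_coords (hi : i < R + 2) (ht' : t' < L.length) (hi' : i' < R + 2) :
    entry R L t i t' i' / (L.length * (R + 2)) / (R + 2) = t ∧
    entry R L t i t' i' / (L.length * (R + 2)) % (R + 2) = i ∧
    entry R L t i t' i' % (L.length * (R + 2)) / (R + 2) = t' ∧
    entry R L t i t' i' % (L.length * (R + 2)) % (R + 2) = i' := by
  have h1 : t' * (R + 2) + i' < L.length * (R + 2) := Slot.vtx_aux ht' hi'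
  have e : entry R L t i t' i' = L.length * (R + 2) * ((R + 2) * t + i) +
      ((R + 2) * t' + i') := by
    unfold entry
    ring
  rw [mul_comm t'] at h1
  rw [e, Nat.mul_add_div (by omega), Nat.mul_add_mod, Nat.div_eq_of_lt h1, Nat.mod_eq_of_lt h1,
    add_zero, Nat.mul_add_div (by omega), Nat.mul_add_div (by omega), Nat.mul_add_mod,
    Nat.mul_add_mod, Nat.div_eq_of_lt hi, Nat.div_eq_of_lt hi', Nat.mod_eq_of_lt hi,
    Nat.mod_eq_of_lt hi']
  simp

/-- The first `k` entries of the matrices have been written. -/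
structure Built (R : ℕ) (L : List Slot) (k N : ℕ) (s : Store) : Prop where
  slots : HoldsSlots L s
  regs : s 26 0 = R
  pos : s 31 0 = k
  card : s 32 0 = N
  card' : ∀ i, i ≠ 0 → s 32 i = 0
  adj : ∀ p, s 33 p = if p < k then (if plusAt R L p + minusAt R L p ≠ 0 then 1 else 0) else 0
  plus : ∀ p, s 34 p = if p < k then plusAt R L p - minusAt R L p else 0
  minus : ∀ p, s 35 p = if p < k then minusAt R L p - plusAt R L p else 0

theorem Built.congr {k N : ℕ} {s' : Store} (h : Built R L k N s)
    (hs : ∀ a ∈ [3, 4, 5, 6, 7, 8, 26, 31, 32, 33, 34, 35], s' a = s a) : Built R L k N s' := by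
  have hsl : HoldsSlots L s' := h.slots.congr fun a ha => hs a (by revert a; decide)
  simp only [List.mem_cons, List.not_mem_nil, or_false, forall_eq_or_imp, forall_eq] at hs
  obtain ⟨-, -, -, -, -, -, h1, h2, h3, h4, h5, h6⟩ := hs
  exact ⟨hsl, by rw [h1, h.regs], by rw [h2, h.pos], by rw [h3, h.card],
    by rw [h3]; exact h.card', by rw [h4]; exact h.adj, by rw [h5]; exact h.plus,
    by rw [h6]; exact h.minus⟩

theorem Built.set {k N a j v : ℕ} (h : Built R L k N s)
    (ha : a ∉ [3, 4, 5, 6, 7, 8, 26, 31, 32, 33, 34, 35]) : Built R L k N (s.set a j v) :=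
  h.congr fun _ hb => Store.set_of_ne _ _ _ fun e => ha (e ▸ hb)

/-- Write the current entry. -/
def entryProg : Prog :=
  (asg 22 plusE).seq ((asg 23 minusE).seq
    ((Prog.write 33 (sc 31) (.sub (.const 1) (.sub (.const 1) (.add (sc 22) (sc 23))))).seq
      ((Prog.write 34 (sc 31) (.sub (sc 22) (sc 23))).seq
        ((Prog.write 35 (sc 31) (.sub (sc 23) (sc 22))).seq
          (asg 31 (.add (sc 31) (.const 1)))))))

theorem WP.entryProg {N : ℕ} (h : Built R L (entry R L t i t' i') N s) (h1 : s 27 0 = t)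
    (h2 : s 28 0 = i) (h3 : s 29 0 = t') (h4 : s 30 0 = i') (hi : i < R + 2)
    (ht' : t' < L.length) (hi' : i' < R + 2) :
    WP entryProg s 500 (Built R L (entry R L t i t' i' + 1) N) := by
  obtain ⟨c1, c2, c3, c4⟩ := entry_coords (t := t) (L := L) hi ht' hi'
  have ep : plusE.eval s = plusAt R L (entry R L t i t' i') := by
    rw [eval_plusE h.slots h.regs h1 h2 h3 h4 hi, plusAt, c1, c2, c3, c4]
  have em : ∀ v, minusE.eval (s.set 22 0 v) = minusAt R L (entry R L t i t' i') := by
    intro v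
    rw [Expr.eval_congr (s := s) fun a ha => Store.set_of_ne _ _ _ ?_]
    · rw [eval_minusE h.slots h.regs h1 h2 h3 h4, minusAt, c1, c2, c3, c4]
    · revert a
      decide
  generalize entry R L t i t' i' = k at *
  refine (WP.asg_seq <| WP.asg_seq <| WP.write_seq <| WP.write_seq <| WP.write_seq <|
    WP.asg ?_).mono ?_ fun _ h => h
  · rw [ep, em]
    refine ⟨?_, ?_, ?_, ?_, fun j hj => ?_, fun p => ?_, fun p => ?_, fun p => ?_⟩
    · refine h.slots.congr fun a ha => ?_
      have : a ≠ 22 ∧ a ≠ 23 ∧ a ≠ 33 ∧ a ≠ 34 ∧ a ≠ 35 ∧ a ≠ 31 := by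
        revert a
        decide
      simp only [Store.set_of_ne _ _ _ this.1, Store.set_of_ne _ _ _ this.2.1,
        Store.set_of_ne _ _ _ this.2.2.1, Store.set_of_ne _ _ _ this.2.2.2.1,
        Store.set_of_ne _ _ _ this.2.2.2.2.1, Store.set_of_ne _ _ _ this.2.2.2.2.2]
    · simp [Store.set_apply, h.regs]
    · simp [Store.set_apply, Expr.eval, h.pos]
    · simp [Store.set_apply, h.card]
    · simp [Store.set_apply, h.card' j hj]
    · simp only [Store.set_apply, Expr.eval, eval_sc, h.pos, h.adj]
      rcases lt_trichotomy p k with hp | rfl | hp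
      · simp [hp, hp.ne, hp.trans (Nat.lt_succ_self k)]
      · simp only [Nat.lt_succ_self, if_true]
        simp
        split_ifs <;> omega
      · simp [hp.ne', hp.not_gt, (Nat.succ_le_of_lt hp).not_gt]
    · simp only [Store.set_apply, Expr.eval, eval_sc, h.pos, h.plus]
      rcases lt_trichotomy p k with hp | rfl | hp
      · simp [hp, hp.ne, hp.trans (Nat.lt_succ_self k)]
      · simp
      · simp [hp.ne', hp.not_gt, (Nat.succ_le_of_lt hp).not_gt]
    · simp only [Store.set_apply, Expr.eval, eval_sc, h.pos, h.minus]
      rcases lt_trichotomy p k with hp | rfl | hp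
      · simp [hp, hp.ne, hp.trans (Nat.lt_succ_self k)]
      · simp
      · simp [hp.ne', hp.not_gt, (Nat.succ_le_of_lt hp).not_gt]
  · simp [plusE, minusE, Expr.cost, andE, eqE, neE, ltE]

/-- Write the entries of one row that belong to one layer. -/
def layerProg : Prog := forLoop 30 (.add (sc 26) (.const 2)) entryProg

theorem WP.layerProg {N : ℕ} (h : Built R L (entry R L t i t' 0) N s) (h1 : s 27 0 = t)
    (h2 : s 28 0 = i) (h3 : s 29 0 = t') (hi : i < R + 2) (ht' : t' < L.length) :
    WP layerProg s ((R + 2) * 514 + 14) (Built R L (entry R L t i (t' + 1) 0) N) := by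
  refine (WP.forLoop (N := R + 2) (T := 500) (fun k s => Built R L (entry R L t i t' k) N s ∧
    s 27 0 = t ∧ s 28 0 = i ∧ s 29 0 = t') (by decide +kernel) ?_ ?_ ?_).mono
    (by simp only [cost_sc, Expr.cost]; omega) ?_
  · exact ⟨h.set (by decide), by simp [Store.set_apply, h1], by simp [Store.set_apply, h2],
      by simp [Store.set_apply, h3]⟩
  · rintro k s ⟨h, -⟩
    simp [Expr.eval, h.regs]
  · rintro k hk s ⟨h, h1, h2, h3⟩ h4
    refine (WP.entryProg h h1 h2 h3 h4 hi ht' hk).mono le_rfl fun s' h' f => ⟨?_, ?_, ?_, ?_⟩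
    · exact Built.set (show Built R L (entry R L t i t' (k + 1)) N s' from h') (by decide)
    · rw [Store.set_of_ne _ _ _ (by decide), f 27 (by decide +kernel), h1]
    · rw [Store.set_of_ne _ _ _ (by decide), f 28 (by decide +kernel), h2]
    · rw [Store.set_of_ne _ _ _ (by decide), f 29 (by decide +kernel), h3]
  · rintro s' ⟨h, -⟩
    -- The carry from the last digit to the one before it.
    have : entry R L t i (t' + 1) 0 = entry R L t i t' (R + 2) := by unfold entry; ring
    rwa [this]

/-- Write one row, and count it. -/
def rowProg : Prog := (forLoop 29 (sc 8) layerProg).seq (asg 32 (.add (sc 32) (.const 1)))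

/-- There is one row per vertex, so counting rows yields the number of vertices that the encoding
demands. -/
theorem WP.rowProg {N : ℕ} (h : Built R L (entry R L t i 0 0) N s) (h1 : s 27 0 = t)
    (h2 : s 28 0 = i) (hi : i < R + 2) :
    WP rowProg s (L.length * ((R + 2) * 514 + 30) + 18)
      (Built R L (entry R L t (i + 1) 0 0) (N + 1)) := by
  refine (WP.seq (T' := 6) (WP.forLoop (N := L.length) (T := (R + 2) * 514 + 14)
    (fun k s => Built R L (entry R L t i k 0) N s ∧ s 27 0 = t ∧ s 28 0 = i)
    (by decide +kernel) ?_ ?_ ?_) ?_).mono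
    ?_ fun _ h => h
  · exact ⟨h.set (by decide), by simp [Store.set_apply, h1], by simp [Store.set_apply, h2]⟩
  · rintro k s ⟨h, -⟩
    exact h.slots.1
  · rintro k hk s ⟨h, h1, h2⟩ h3
    refine (WP.layerProg h h1 h2 h3 hi hk).mono le_rfl fun s' h' f => ⟨?_, ?_, ?_⟩
    · exact h'.set (by decide)
    · rw [Store.set_of_ne _ _ _ (by decide), f 27 (by decide +kernel), h1]
    · rw [Store.set_of_ne _ _ _ (by decide), f 28 (by decide +kernel), h2]
  · rintro s' ⟨h, -⟩
    refine (WP.asg ?_).mono (by simp [Expr.cost]) fun _ h => h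
    have e : entry R L t (i + 1) 0 0 = entry R L t i L.length 0 := by unfold entry; ring
    rw [e]
    have hne : ∀ a, a ≠ 32 → ∀ v, (s'.set 32 0 v) a = s' a := fun a ha v =>
      Store.set_of_ne _ _ _ ha
    refine ⟨h.slots.set (by decide), ?_, ?_, ?_, fun j hj => ?_, ?_, ?_, ?_⟩
    · rw [hne _ (by decide), h.regs]
    · rw [hne _ (by decide), h.pos]
    · simp [Store.set_apply, Expr.eval, h.card]
    · simp [Store.set_apply, hj, h.card' j hj]
    · rw [hne _ (by decide)]
      exact h.adj
    · rw [hne _ (by decide)]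
      exact h.plus
    · rw [hne _ (by decide)]
      exact h.minus
  · simp only [cost_sc]
    generalize (R + 2) * 514 = c
    have : L.length * (c + 14 + 2 + 10) ≤ L.length * (c + 30) := Nat.mul_le_mul_left _ (by omega)
    omega

/-- Write all rows. -/
def matrixProg : Prog :=
  forLoop 27 (sc 8) (forLoop 28 (.add (sc 26) (.const 2)) rowProg)

/-- A bound for the running time of `matrixProg`, where `T` is the number of layers and `B` the
number of vertices of a layer. -/
def matrixTime (T B : ℕ) : ℕ := T * (B * (T * (B * 514 + 30) + 40) + 40) + 20

theorem WP.matrixProg (h : Built R L 0 0 s) :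
    WP matrixProg s (matrixTime L.length (R + 2))
      (Built R L (L.length * (R + 2) * (L.length * (R + 2))) (L.length * (R + 2))) := by
  unfold matrixTime
  obtain ⟨r, hr⟩ : ∃ r, L.length * ((R + 2) * 514 + 30) = r := ⟨_, rfl⟩
  rw [hr]
  have hB : (R + 2) * (r + 18 + (2 + 1 + 1) + 10) ≤ (R + 2) * (r + 40) :=
    Nat.mul_le_mul_left _ (by omega)
  obtain ⟨b, hb⟩ : ∃ b, (R + 2) * (r + 40) = b := ⟨_, rfl⟩
  rw [hb] at hB ⊢
  refine (WP.forLoop (N := L.length) (T := b + 14) (fun k s =>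
    Built R L (entry R L k 0 0 0) (k * (R + 2)) s) (by decide +kernel) ?_ ?_ ?_).mono ?_ ?_
  · have e : entry R L 0 0 0 0 = 0 := by simp [entry]
    rw [e, zero_mul]
    exact h.set (by decide)
  · rintro k s h
    exact h.slots.1
  · rintro t ht s h h1
    refine (WP.forLoop (N := R + 2) (T := r + 18)
      (fun k s => Built R L (entry R L t k 0 0) (t * (R + 2) + k) s ∧ s 27 0 = t)
      (by decide +kernel) ?_ ?_ ?_).mono (by simp only [cost_sc, Expr.cost]; omega) ?_
    · exact ⟨h.set (by decide), by simp [Store.set_apply, h1]⟩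
    · rintro k s ⟨h, -⟩
      simp [Expr.eval, h.regs]
    · rintro i hi s ⟨h, h1⟩ h2
      refine (WP.rowProg h h1 h2 hi).mono (by rw [hr]) fun s' h' f => ⟨?_, ?_⟩
      · exact h'.set (by decide)
      · rw [Store.set_of_ne _ _ _ (by decide), f 27 (by decide +kernel), h1]
    · rintro s' ⟨h, -⟩ -
      have e : entry R L (t + 1) 0 0 0 = entry R L t (R + 2) 0 0 := by unfold entry; ring
      rw [e, Nat.succ_mul]
      exact h.set (by decide)
  · have : L.length * (b + 14 + 2 + 10) ≤ L.length * (b + 40) :=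
      Nat.mul_le_mul_left _ (by omega)
    simp only [cost_sc]
    omega
  · intro s' h
    have e : L.length * (R + 2) * (L.length * (R + 2)) = entry R L L.length 0 0 0 := by
      unfold entry
      ring
    rwa [e]

end Entries

/-! ### The matrices as input of the given algorithm -/

theorem getD_ofFn {n : ℕ} (f : Fin n → ℕ) (i : ℕ) :
    (List.ofFn f).getD i 0 = if h : i < n then f ⟨i, h⟩ else 0 := by
  split_ifs with h
  · rw [List.getD_eq_getElem _ _ (by simpa using h), List.getElem_ofFn]
  · exact List.getD_eq_default _ _ (by simpa using h)

/-- The two truncated differences are the positive and the negative part of the weight. With the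
arrays from 36 on still empty, the memory from array 32 on is exactly an initial memory. -/
theorem Built.eq_load {R : ℕ} {L : List Slot} {s : Store} (hL : ∀ c ∈ L, c.WF R)
    (h : Built R L (L.length * (R + 2) * (L.length * (R + 2))) (L.length * (R + 2)) s)
    (h0 : ∀ a, 36 ≤ a → s a = fun _ => 0) (a : ℕ) :
    s (a + 32) = load (Slot.game R L hL).encode a := by
  classical
  funext p
  unfold ASHG.encode load
  rcases a with _ | _ | _ | _ | a
  · cases p with
    | zero => exact h.card
    | succ p => exact h.card' _ (by omega)
  · rw [show (0 + 1 + 32) = 33 from rfl, h.adj]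
    simp only [List.getD_cons_succ, List.getD_cons_zero]
    rw [getD_ofFn]
    split_ifs with h1 h2 h3 h3
    · rfl
    · exact absurd h2 h3
    · exact absurd h3 h2
    · rfl
    · rfl
  · rw [show (0 + 1 + 1 + 32) = 34 from rfl, h.plus]
    simp only [List.getD_cons_succ, List.getD_cons_zero]
    rw [getD_ofFn]
    split_ifs with h1
    · simp only [Slot.game, Fin.divNat, Fin.modNat, Int.toNat_sub]
      rfl
    · rfl
  · rw [show (0 + 1 + 1 + 1 + 32) = 35 from rfl, h.minus]
    simp only [List.getD_cons_succ, List.getD_cons_zero]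
    rw [getD_ofFn]
    split_ifs with h1
    · simp only [Slot.game, Fin.divNat, Fin.modNat, neg_sub, Int.toNat_sub]
      rfl
    · rfl
  · rw [h0 _ (by omega)]
    rfl

end RAM

/-! ### The reduction -/

namespace RAM

/-- Translate a formula into a game, and run `P` on the latter. -/
def reduce (P : Prog) : Prog :=
  slotsProg.seq ((asg 26 (.add (.add (sc 12) (sc 10)) (.const 3))).seq ((asg 31 (.const 0)).seq
    (matrixProg.seq ((P.shift 32).seq (asg 0 (sc 32))))))

/-- A bound for the time that the translation takes. -/
def reduceTime (n m : ℕ) : ℕ :=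
  slotsTime n m (ThreeCNF.groupSize n) (2 ^ ThreeCNF.groupSize n) +
    matrixTime (1 + ((n / ThreeCNF.groupSize n + 1) * (2 ^ ThreeCNF.groupSize n + 1) +
      m * (3 * (2 ^ ThreeCNF.groupSize n + 2) + 2))) (ThreeCNF.numRegs n + 2) + 20

open ThreeCNF in
theorem _root_.ThreeCNF.length_slots {n : ℕ} (φ : ThreeCNF n) :
    φ.slots.length = 1 + ((n / groupSize n + 1) * (2 ^ groupSize n + 1) +
      φ.length * (3 * (2 ^ groupSize n + 2) + 2)) := by
  rw [slots, List.length_cons, Slot.length_satSlots, add_comm]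

/-- Renaming arrays does not affect the time of `P`, so only the time of the translation and of
copying the answer is added. -/
theorem answers_reduce {P : Prog} {n : ℕ} (φ : ThreeCNF n) {T : ℝ}
    (h : Answers P (Slot.game (ThreeCNF.numRegs n) φ.slots φ.slots_wf).encode
      (∃ π, (Slot.game (ThreeCNF.numRegs n) φ.slots φ.slots_wf).ConnectedNashStable π) T) :
    Answers (reduce P) φ.encode φ.Satisfiable (T + reduceTime n φ.length) := by
  rw [φ.exists_connectedNashStable_iff] at h
  obtain ⟨t, s, hrun, ht, hs⟩ := h
  have hz : ∀ a, 3 ≤ a → load φ.encode a = fun _ => 0 := by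
    rintro (_ | _ | _ | a) ha
    · omega
    · omega
    · omega
    · rfl
  obtain ⟨t₁, s₁, r₁, ht₁, ⟨hL, hR⟩, f₁⟩ := (WP.slotsProg φ).frame
  -- Hence the arrays reserved for the game and for `P` are still zero after the register program
  -- has been written down.
  have hw₁ : ∀ a, a ∈ slotsProg.writes → a < 26 := by decide +kernel
  have f₁' : ∀ a, 26 ≤ a → s₁ a = fun _ => 0 := fun a ha => by
    rw [f₁ a fun h => absurd (hw₁ a h) (by omega), hz a (by omega)]
  set s₂ : Store := (s₁.set 26 0 (ThreeCNF.numRegs n)).set 31 0 0 with hs₂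
  have r₂ : Runs (asg 26 (.add (.add (sc 12) (sc 10)) (.const 3))) s₁ 9
      (s₁.set 26 0 (ThreeCNF.numRegs n)) := by
    rw [← hR]
    exact Runs.write 26 (.const 0) (.add (.add (sc 12) (sc 10)) (.const 3)) s₁
  have r₃ : Runs (asg 31 (.const 0)) (s₁.set 26 0 (ThreeCNF.numRegs n)) 3 s₂ :=
    Runs.write 31 (.const 0) (.const 0) _
  have hne : ∀ a, a ≠ 26 → a ≠ 31 → s₂ a = s₁ a := fun a h1 h2 => by
    rw [hs₂, Store.set_of_ne _ _ _ h2, Store.set_of_ne _ _ _ h1]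
  have hB : Built (ThreeCNF.numRegs n) φ.slots 0 0 s₂ := by
    refine ⟨(hL.set (by decide)).set (by decide), ?_, ?_, ?_, fun i _ => ?_, fun p => ?_,
      fun p => ?_, fun p => ?_⟩
    · simp [hs₂, Store.set_apply]
    · simp [hs₂, Store.set_apply]
    · rw [hne _ (by decide) (by decide), f₁' _ (by decide)]
    · rw [hne _ (by decide) (by decide), f₁' _ (by decide)]
    · rw [hne _ (by decide) (by decide), f₁' _ (by decide)]
      rfl
    · rw [hne _ (by decide) (by decide), f₁' _ (by decide)]
      rfl
    · rw [hne _ (by decide) (by decide), f₁' _ (by decide)]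
      rfl
  obtain ⟨t₄, s₄, r₄, ht₄, hB₄, f₄⟩ := (WP.matrixProg hB).frame
  have hw₄ : ∀ a, a ∈ matrixProg.writes → a < 36 := by decide +kernel
  have hload := hB₄.eq_load φ.slots_wf fun a ha => by
    rw [f₄ a fun h => absurd (hw₄ a h) (by omega), hne a (by omega) (by omega),
      f₁' a (by omega)]
  obtain ⟨s₅, r₅, h₅⟩ := hrun.shift 32 hload
  have r₆ : Runs (asg 0 (sc 32)) s₅ 4 (s₅.set 0 0 (s 0 0)) := by
    have := Runs.write 0 (.const 0) (sc 32) s₅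
    rwa [eval_sc, h₅ 0] at this
  refine ⟨_, _, r₁.seq (r₂.seq (r₃.seq (r₄.seq (r₅.seq r₆)))), ?_, ?_⟩
  · rw [φ.length_slots] at ht₄
    have : t₁ + (9 + (3 + (t₄ + 4))) ≤ reduceTime n φ.length := by
      unfold reduceTime
      omega
    have : ((t₁ + (9 + (3 + (t₄ + 4))) : ℕ) : ℝ) ≤ reduceTime n φ.length := by
      exact_mod_cast this
    push_cast at this ⊢
    linarith
  · simpa [Store.set_apply] using hs

end RAM

/-! ### Estimates -/

namespace ThreeCNF

theorem four_pow_groupSize_le {n : ℕ} (hn : n ≠ 0) : 4 ^ groupSize n ≤ 4 * n := by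
  unfold groupSize
  rw [pow_succ, mul_comm]
  exact Nat.mul_le_mul_left _ (Nat.pow_log_le_self 4 hn)

theorem lt_four_pow_groupSize (n : ℕ) : n < 4 ^ groupSize n :=
  Nat.lt_pow_succ_log_self (by norm_num) n

theorem two_pow_groupSize_le (n : ℕ) : 2 ^ groupSize n ≤ 2 * (n + 1) := by
  unfold groupSize
  rw [pow_succ, mul_comm]
  refine Nat.mul_le_mul_left _ ?_
  rcases eq_or_ne n 0 with rfl | hn
  · simp
  · exact ((Nat.pow_le_pow_left (by norm_num) _).trans (Nat.pow_log_le_self 4 hn)).trans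
      (Nat.le_succ n)

theorem groupSize_le (n : ℕ) : groupSize n ≤ n + 1 :=
  Nat.succ_le_succ (Nat.log_le_self 4 n)

theorem numRegs_add_two_le (n m : ℕ) : numRegs n + 2 ≤ 8 * (n + m + 1) := by
  have := two_pow_groupSize_le n
  have : n / groupSize n ≤ n := Nat.div_le_self _ _
  unfold numRegs
  omega

theorem slots_length_le (n m : ℕ) : 1 + ((n / groupSize n + 1) * (2 ^ groupSize n + 1) +
    m * (3 * (2 ^ groupSize n + 2) + 2)) ≤ 20 * (n + m + 1) ^ 2 := by
  have h1 : n / groupSize n + 1 ≤ n + m + 1 := by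
    have : n / groupSize n ≤ n := Nat.div_le_self _ _
    omega
  have h2 : 2 ^ groupSize n ≤ 2 * (n + m + 1) := (two_pow_groupSize_le n).trans (by omega)
  have h3 : m ≤ n + m + 1 := by omega
  have h4 : 1 ≤ n + m + 1 := by omega
  generalize n + m + 1 = X at *
  calc _ ≤ 1 + (X * (2 * X + 1) + X * (3 * (2 * X + 2) + 2)) := by gcongr
    _ ≤ 20 * X ^ 2 := by nlinarith

/-- The game has `O(X ^ 3)` vertices for `X = n + m + 1`, and the matrices, with `O(X ^ 6)` entries,
dominate. -/
theorem reduceTime_le : ∃ K : ℕ, ∀ n m, RAM.reduceTime n m ≤ K * (n + m + 1) ^ 6 := by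
  refine ⟨100000000, fun n m => ?_⟩
  have h1 := slots_length_le n m
  have h2 := numRegs_add_two_le n m
  have h3 : 2 ^ groupSize n ≤ 2 * (n + m + 1) := (two_pow_groupSize_le n).trans (by omega)
  have h4 : groupSize n ≤ n + m + 1 := (groupSize_le n).trans (by omega)
  have h5 : n ≤ n + m + 1 := by omega
  have h5' : n + 1 ≤ n + m + 1 := by omega
  have h6 : m ≤ n + m + 1 := by omega
  have h7 : 1 ≤ n + m + 1 := by omega
  unfold RAM.reduceTime RAM.matrixTime RAM.slotsTime
  generalize n + m + 1 = X at *
  calc _ ≤ X * 100 + X * (2 * X * 60 + 80) +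
        X * (3 * (X * 24 + X * 19 + 2 * X * (2 * X * 46 + 150) + 260)) + 200 +
        (20 * X ^ 2 * (8 * X * (20 * X ^ 2 * (8 * X * 514 + 30) + 40) + 40) + 20) + 20 := by
        gcongr
    _ ≤ 100000000 * X ^ 6 := by
        have p0 : 1 ≤ X ^ 6 := Nat.one_le_pow _ _ h7
        have p1 : X ^ 1 ≤ X ^ 6 := Nat.pow_le_pow_right h7 (by norm_num)
        have p2 : X ^ 2 ≤ X ^ 6 := Nat.pow_le_pow_right h7 (by norm_num)
        have p3 : X ^ 3 ≤ X ^ 6 := Nat.pow_le_pow_right h7 (by norm_num)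
        have p4 : X ^ 4 ≤ X ^ 6 := Nat.pow_le_pow_right h7 (by norm_num)
        have p5 : X ^ 5 ≤ X ^ 6 := Nat.pow_le_pow_right h7 (by norm_num)
        rw [pow_one] at p1
        nlinarith

/-! ### From `p^{o(p)}` to `2^{o(n)}` -/

/-- A bound for the pathwidth of the game of a formula with `n` variables. -/
def pwBound (n : ℕ) : ℕ := 2 * (numRegs n + 2)

/-- The bound is at most linear in `n < 4 ^ groupSize n`; the constants are absorbed by `2 ^ 5`, and
`5 + 2 l ≤ 7 l` for `l ≥ 1`. -/
theorem logb_pwBound_le (n : ℕ) : Real.logb 2 ((pwBound n : ℝ) + 2) ≤ 7 * groupSize n := by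
  have h1 : pwBound n + 2 ≤ 2 ^ (7 * groupSize n) := by
    have h2 := two_pow_groupSize_le n
    have h3 := lt_four_pow_groupSize n
    have h4 : n / groupSize n ≤ n := Nat.div_le_self _ _
    have h5 : 1 ≤ groupSize n := Nat.succ_pos _
    have h6 : 2 ^ 5 * 4 ^ groupSize n ≤ 2 ^ (7 * groupSize n) := by
      rw [show 4 = 2 ^ 2 by norm_num, ← pow_mul, ← pow_add]
      exact Nat.pow_le_pow_right (by norm_num) (by omega)
    unfold pwBound numRegs
    omega
  rw [Real.logb_le_iff_le_rpow (by norm_num) (by positivity)]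
  calc ((pwBound n : ℝ) + 2) = ((pwBound n + 2 : ℕ) : ℝ) := by push_cast; ring
    _ ≤ ((2 ^ (7 * groupSize n) : ℕ) : ℝ) := by exact_mod_cast h1
    _ = (2 : ℝ) ^ ((7 * groupSize n : ℕ) : ℝ) := by rw [Real.rpow_natCast]; push_cast; rfl
    _ = _ := by push_cast; rfl

/-- This is why groups have logarithmic size to the base 4: `2 ^ l * l ≤ 4 ^ l ≤ 4 * n`, so the
registers for assignments do not outweigh the `n / l` groups by more than a constant. The constant
is `(2 + 12) * 4 + 2 = 58`. -/
theorem pwBound_mul_le {n : ℕ} (hn : n ≠ 0) : pwBound n * groupSize n ≤ 58 * n := by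
  have h1 := four_pow_groupSize_le hn
  have h2 : groupSize n ≤ 2 ^ groupSize n := (Nat.lt_two_pow_self).le
  have h3 : 2 ^ groupSize n * 2 ^ groupSize n = 4 ^ groupSize n := by
    rw [← mul_pow]
    norm_num
  have h4 : n / groupSize n * groupSize n ≤ n := Nat.div_mul_le_self _ _
  have h5 : 2 ^ groupSize n * groupSize n ≤ 2 ^ groupSize n * 2 ^ groupSize n :=
    Nat.mul_le_mul_left _ h2
  have h6 : groupSize n ≤ 4 ^ groupSize n := (Nat.lt_pow_self (by norm_num)).le
  unfold pwBound numRegs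
  calc _ = 2 * (2 ^ groupSize n * groupSize n) + 2 * (n / groupSize n * groupSize n) +
        12 * groupSize n := by ring
    _ ≤ 58 * n := by omega

theorem groupSize_sq_le {n : ℕ} (hn : n ≠ 0) : groupSize n ^ 2 ≤ 4 * n := by
  refine le_trans ?_ (four_pow_groupSize_le hn)
  rw [show 4 = 2 ^ 2 by norm_num, ← pow_mul, mul_comm 2, pow_mul]
  exact Nat.pow_le_pow_left (Nat.lt_two_pow_self).le 2

/-- The exponent of `2` in the running time of the algorithm for 3-SAT. -/
noncomputable def exponent (f : ℕ → ℝ) (n : ℕ) : ℝ :=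
  -- Only an upper bound for the pathwidth is available and `f` need not be monotone, so the maximum
  -- extends over all candidates `q`.
  (Finset.range (pwBound n + 1)).sup' ⟨0, by simp⟩ fun q => max (f q) 0 * Real.logb 2 (q + 2)

theorem logb_nonneg (q : ℕ) : 0 ≤ Real.logb 2 ((q : ℝ) + 2) :=
  Real.logb_nonneg (by norm_num) (by linarith [(Nat.cast_nonneg q : (0 : ℝ) ≤ q)])

theorem le_exponent (f : ℕ → ℝ) {n q : ℕ} (hq : q ≤ pwBound n) :
    max (f q) 0 * Real.logb 2 (q + 2) ≤ exponent f n :=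
  Finset.le_sup' (fun q : ℕ => max (f q) 0 * Real.logb 2 (q + 2))
    (Finset.mem_range.2 (Nat.lt_succ_of_le hq))

theorem exponent_nonneg (f : ℕ → ℝ) (n : ℕ) : 0 ≤ exponent f n :=
  (mul_nonneg (le_max_right _ _) (logb_nonneg 0)).trans (le_exponent f (Nat.zero_le _))

theorem rpow_le_two_rpow_exponent (f : ℕ → ℝ) {n q : ℕ} (hq : q ≤ pwBound n) :
    ((q : ℝ) + 2) ^ f q ≤ 2 ^ exponent f n := by
  have h1 : (1 : ℝ) ≤ (q : ℝ) + 2 := by linarith [(Nat.cast_nonneg q : (0 : ℝ) ≤ q)]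
  calc ((q : ℝ) + 2) ^ f q ≤ ((q : ℝ) + 2) ^ max (f q) 0 :=
        Real.rpow_le_rpow_of_exponent_le h1 (le_max_left _ _)
    _ = (2 ^ Real.logb 2 ((q : ℝ) + 2)) ^ max (f q) 0 := by
        rw [Real.rpow_logb (by norm_num) (by norm_num) (by linarith)]
    _ = 2 ^ (max (f q) 0 * Real.logb 2 ((q : ℝ) + 2)) := by
        rw [← Real.rpow_mul (by norm_num), mul_comm]
    _ ≤ 2 ^ exponent f n := Real.rpow_le_rpow_of_exponent_le (by norm_num) (le_exponent f hq)

/-- The finitely many values below the threshold are absorbed by `K`. -/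
theorem exists_le_linear {f : ℕ → ℝ} (hf : f =o[atTop] fun p : ℕ => (p : ℝ)) {ε : ℝ}
    (hε : 0 < ε) : ∃ K, 0 ≤ K ∧ ∀ q : ℕ, max (f q) 0 ≤ ε * q + K := by
  obtain ⟨Q, hQ⟩ := eventually_atTop.1 (isLittleO_iff.1 hf hε)
  have hK : 0 ≤ ∑ q ∈ Finset.range Q, |f q| := Finset.sum_nonneg fun _ _ => abs_nonneg _
  refine ⟨_, hK, fun q => ?_⟩
  have h0 : 0 ≤ ε * q := by positivity
  refine max_le ?_ (by positivity)
  rcases lt_or_ge q Q with h | h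
  · have := Finset.single_le_sum (f := fun q => |f q|) (fun _ _ => abs_nonneg _)
      (Finset.mem_range.2 h)
    linarith [le_abs_self (f q)]
  · have := hQ q h
    rw [Real.norm_eq_abs, Real.norm_eq_abs, abs_of_nonneg (Nat.cast_nonneg q : (0 : ℝ) ≤ q)] at this
    linarith [le_abs_self (f q)]

/-- For `l = groupSize n`, the exponent is at most `(ε p + K) * 7 l` with `p * l ≤ 58 * n`, and `l`
itself is `O(√n)`. -/
theorem exponent_isLittleO {f : ℕ → ℝ} (hf : f =o[atTop] fun p : ℕ => (p : ℝ)) :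
    exponent f =o[atTop] fun n : ℕ => (n : ℝ) := by
  refine isLittleO_iff.2 fun c hc => ?_
  -- As `812 = 2 * 7 * 58`, the linear part contributes at most `c / 2 * n`.
  obtain ⟨K, hK, hfK⟩ := exists_le_linear hf (ε := c / 812) (by positivity)
  filter_upwards [eventually_ge_atTop 1,
    eventually_ge_atTop ⌈(14 * K / c) * (56 * K / c)⌉₊] with n hn1 hn2
  have hn0 : n ≠ 0 := by omega
  rw [Real.norm_eq_abs, Real.norm_eq_abs, abs_of_nonneg (Nat.cast_nonneg n : (0 : ℝ) ≤ n),
    abs_of_nonneg (exponent_nonneg f n)]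
  have hg0 : (0 : ℝ) ≤ groupSize n := Nat.cast_nonneg _
  have h1 : (pwBound n : ℝ) * groupSize n ≤ 58 * n := by exact_mod_cast pwBound_mul_le hn0
  have h2 : (groupSize n : ℝ) ^ 2 ≤ 4 * n := by exact_mod_cast groupSize_sq_le hn0
  have h3 : exponent f n ≤ (c / 812 * pwBound n + K) * (7 * groupSize n) := by
    refine Finset.sup'_le _ _ fun q hq => ?_
    have hq : (q : ℝ) ≤ pwBound n := by
      exact_mod_cast Nat.lt_succ_iff.1 (Finset.mem_range.1 hq)
    refine mul_le_mul ((hfK q).trans ?_) ?_ (logb_nonneg q) (by positivity)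
    · gcongr
    · refine le_trans ?_ (logb_pwBound_le n)
      exact Real.logb_le_logb_of_le (by norm_num) (by positivity) (by linarith)
  -- A large group size is controlled by its square, which is at most `4 * n`; for a small one the
  -- threshold on `n` is chosen accordingly.
  have h4 : 7 * K * groupSize n ≤ c / 2 * n := by
    rcases le_or_gt (56 * K / c) (groupSize n) with h | h
    · have h5 : 56 * K ≤ groupSize n * c := (div_le_iff₀ hc).1 h
      nlinarith
    · have h5 := Nat.ceil_le.1 hn2
      have h6 : 14 * K / c * groupSize n ≤ n :=
        (mul_le_mul_of_nonneg_left h.le (by positivity)).trans h5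
      have h7 : 14 * K / c * groupSize n * c = 14 * K * groupSize n := by
        field_simp
      nlinarith
  have h8 : c / 812 * pwBound n * (7 * groupSize n) ≤ c / 2 * n := by
    have := mul_le_mul_of_nonneg_left h1 (by positivity : 0 ≤ c / 116)
    linarith
  linarith

end ThreeCNF

/-! ### The corollary -/

theorem mainTheorem8 :
    ∃ Δ W : ℕ, ETH →
      ¬ ∃ (P : RAM.Prog) (f : ℕ → ℝ) (C : ℝ) (d : ℕ),
        f =o[atTop] (fun p : ℕ => (p : ℝ)) ∧
        ∀ (n : ℕ) (G : ASHG (Fin n)),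
          G.maxDegree ≤ Δ → (∀ u v, |G.weight u v| ≤ (W : ℤ)) →
            RAM.Answers P G.encode
              (∃ π : Finpartition (Finset.univ : Finset (Fin n)), G.ConnectedNashStable π)
              (C * ((pathwidth G.underlying : ℝ) + 2) ^ f (pathwidth G.underlying) *
                ((n : ℝ) + 1) ^ d) := by
  refine ⟨10, 2, fun heth ⟨P, f, C, d, hf, hP⟩ => heth ?_⟩
  obtain ⟨K, hK⟩ := ThreeCNF.reduceTime_le
  -- The exponent `3 * d` stems from the cubic number of vertices and 6 from the time of the
  -- translation; `|C|` is used because `C` may be negative.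
  refine ⟨RAM.reduce P, ThreeCNF.exponent f, |C| * 161 ^ d + K, 3 * d + 6,
    ThreeCNF.exponent_isLittleO hf, fun n φ => ?_⟩
  obtain ⟨t, s, hr, ht, hs⟩ := RAM.answers_reduce φ (hP _ _ (Slot.maxDegree_game_le φ.slots_wf)
    (Slot.abs_weight_le φ.slots_wf))
  refine ⟨t, s, hr, ht.trans ?_, hs⟩
  set X : ℝ := (n : ℝ) + φ.length + 1 with hX
  have hX1 : 1 ≤ X := by
    have h1 : (0 : ℝ) ≤ n := Nat.cast_nonneg n
    have h2 : (0 : ℝ) ≤ φ.length := Nat.cast_nonneg _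
    linarith
  have hE : (1 : ℝ) ≤ 2 ^ ThreeCNF.exponent f n :=
    Real.one_le_rpow (by norm_num) (ThreeCNF.exponent_nonneg f n)
  -- Here `161 = 20 * 8 + 1`, from the bounds for the layers and for the vertices of a layer.
  have h1 : ((φ.slots.length * (ThreeCNF.numRegs n + 2) : ℕ) : ℝ) + 1 ≤ 161 * X ^ 3 := by
    have h2 := Nat.mul_le_mul (ThreeCNF.slots_length_le n φ.length)
      (ThreeCNF.numRegs_add_two_le n φ.length)
    rw [← φ.length_slots] at h2
    have h3 : ((φ.slots.length * (ThreeCNF.numRegs n + 2) : ℕ) : ℝ) ≤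
        20 * X ^ 2 * (8 * X) := by
      rw [hX]
      exact_mod_cast h2
    have h4 : 1 ≤ X ^ 3 := one_le_pow₀ hX1
    nlinarith
  have h2 : (RAM.reduceTime n φ.length : ℝ) ≤ K * X ^ 6 := by
    rw [hX]
    exact_mod_cast hK n φ.length
  have h3 := ThreeCNF.rpow_le_two_rpow_exponent f (n := n)
    (Slot.pathwidth_game_le (R := ThreeCNF.numRegs n) φ.slots_wf)
  have hp : X ^ (3 * d) ≤ X ^ (3 * d + 6) := pow_le_pow_right₀ hX1 (by omega)
  have hp' : X ^ 6 ≤ X ^ (3 * d + 6) := pow_le_pow_right₀ hX1 (by omega)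
  calc _ ≤ |C| * 2 ^ ThreeCNF.exponent f n * (161 * X ^ 3) ^ d + K * X ^ 6 := by
        refine add_le_add ?_ h2
        gcongr
        exact le_abs_self C
    _ = |C| * 161 ^ d * 2 ^ ThreeCNF.exponent f n * X ^ (3 * d) + K * 1 * X ^ 6 := by
        rw [mul_pow, ← pow_mul]
        ring
    _ ≤ |C| * 161 ^ d * 2 ^ ThreeCNF.exponent f n * X ^ (3 * d + 6) +
        K * 2 ^ ThreeCNF.exponent f n * X ^ (3 * d + 6) := by
        gcongr
    _ = _ := by ring
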